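/- Notation. All operators are bounded linear operators on complex Hilbert spaces. For $k\ge 1$ let $\Gamma_k\subset\mathbb C^k$ be the closed symmetrized polydisc $$\Gamma_k=\Big\{\Big(\sum_{1\le i\le k} z_i,\ \sum_{1\le i<j\le k}z_iz_j,\ \dots,\ \prod_{i=1}^k z_i\Big): |z_i|\le 1,\ i=1,\dots,k\Big\}.$$ A commuting $k$-tuple $\underline T=(T_1,\dots,T_k)$ of operators on a Hilbert space is a $\Gamma_k$-contraction if its Taylor joint spectrum is contained in $\Gamma_k$ and $\|f(\underline T)\|\le\sup_{\Gamma_k}|f|$ for every polynomial $f\in\mathbb C[x_1,\dots,x_k]$. For a contraction $P$ on $\mathcal H$ put $D_P=(I-P^*P)^{1/2}$ and $\mathcal D_P=\overline{\mathrm{Ran}}\,D_P$. The characteristic function of $P$ is $$\Theta_P(z)=\big[-P+zD_{P^*}(I-zP^*)^{-1}D_P\big]\big|_{\mathcal D_P}:\mathcal D_P\to\mathcal D_{P^*},\qquad z\in\mathbb D.$$ $P$ is pure if ${P^*}^k\to0$ strongly as $k\to\infty$. For $n\ge2$, the fundamental operator tuple of a $\Gamma_n$-contraction $(S_1,\dots,S_{n-1},P)$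 is the unique tuple $(F_1,\dots,F_{n-1})$ of operators in $\mathcal B(\mathcal D_P)$ with $S_i-S_{n-i}^*P=D_PF_iD_P$ for $i=1,\dots,n-1$. Theorem. Let $n\ge 2$ and let $\mathcal H$ be a complex Hilbert space. (a) Let $(A_1,\dots,A_{n-1})$ and $(B_1,\dots,B_{n-1})$ be the fundamental operator tuples of a $\Gamma_n$-contraction $(S_1,\dots,S_{n-1},P)$ on $\mathcal H$ and of its adjoint $(S_1^*,\dots,S_{n-1}^*,P^*)$, respectively. Then for each $i=1,\dots,n-1$, $$(B_i^*+B_{n-i}z)\,\Theta_P(z)=\Theta_P(z)\,(A_i+A_{n-i}^*z)\quad\text{for all }z\in\mathbb D.\tag{1}$$ (b) Conversely, let $P$ be a pure contraction on $\mathcal H$, and let $A_1,\dots,A_{n-1}\in\mathcal B(\mathcal D_P)$ and $B_1,\dots,B_{n-1}\in\mathcal B(\mathcal D_{P^*})$ be such that $$\Big(\tfrac{n-1}{n}(A_1^*+A_{n-1}z),\ \tfrac{n-2}{n}(A_2^*+A_{n-2}z),\ \dots,\ \tfrac1n(A_{n-1}^*+A_1z)\Big)$$ and $$\Big(\tfrac{n-1}{n}(B_1^*+B_{n-1}z),\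 \tfrac{n-2}{n}(B_2^*+B_{n-2}z),\ \dots,\ \tfrac1n(B_{n-1}^*+B_1z)\Big)$$ are $\Gamma_{n-1}$-contractions for all $z\in\mathbb D$. If these operators satisfy (1) for each $i=1,\dots,n-1$, then there exist operators $S_1,\dots,S_{n-1}$ on $\mathcal H$ such that $(S_1,\dots,S_{n-1},P)$ is a $\Gamma_n$-contraction, $(A_1,\dots,A_{n-1})$ is the fundamental operator tuple of $(S_1,\dots,S_{n-1},P)$, and $(B_1,\dots,B_{n-1})$ is the fundamental operator tuple of $(S_1^*,\dots,S_{n-1}^*,P^*)$. -/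

import Mathlib

open ContinuousLinearMap
open scoped TensorProduct

noncomputable section

namespace SymPolydisc

/-- The closed symmetrized polydisc `Γ_k ⊆ ℂ^k`: all points `(e₁(z), …, e_k(z))` with
`z ∈ ℂ^k`, `|z_j| ≤ 1`, where `e_i` is the `i`-th elementary symmetric function. The coordinate
with (zero-based) index `i` is `e_{i+1}`; the last coordinate is the product of the `z_j`. -/
def closedSymDisc (k : ℕ) : Set (Fin k → ℂ) :=
  {s | ∃ z : Fin k → ℂ, (∀ j, ‖z j‖ ≤ 1) ∧
    ∀ i : Fin k, s i = ∑ t ∈ Finset.powersetCard (i.val + 1) Finset.univ, ∏ j ∈ t, z j}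

section Operators

variable {H : Type*} [NormedAddCommGroup H] [InnerProductSpace ℂ H]

/-- The operator `D_T = ∑ i, T_i ⊗ E_i` on `H ⊗ Λ(ℂ^k)`, where `E_i` is the creation operator
`ξ ↦ e_i ∧ ξ` on the exterior algebra. -/
def koszulMap {k : ℕ} (T : Fin k → (H →L[ℂ] H)) :
    (H ⊗[ℂ] ExteriorAlgebra ℂ (Fin k → ℂ)) →ₗ[ℂ] (H ⊗[ℂ] ExteriorAlgebra ℂ (Fin k → ℂ)) :=
  ∑ i, TensorProduct.map (T i : H →ₗ[ℂ] H)
    (LinearMap.mulLeft ℂ (ExteriorAlgebra.ι ℂ (Pi.single i (1 : ℂ) : Fin k → ℂ)))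

/-- The Taylor joint spectrum of a (commuting) tuple: those `lam` for which the Koszul complex of
`T - lam` is not exact. -/
def taylorSpectrum {k : ℕ} (T : Fin k → (H →L[ℂ] H)) : Set (Fin k → ℂ) :=
  {lam | LinearMap.range (koszulMap fun i => T i - lam i • (1 : H →L[ℂ] H)) ≠
    LinearMap.ker (koszulMap fun i => T i - lam i • (1 : H →L[ℂ] H))}

/-- The value `f(T₁, …, T_k)` of a polynomial at a commuting tuple of operators. -/
def polyEval {k : ℕ} (T : Fin k → (H →L[ℂ] H)) (f : MvPolynomial (Fin k) ℂ) : H →L[ℂ] H :=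
  ∑ d ∈ f.support, f.coeff d • (List.ofFn fun i => T i ^ d i).prod

/-- `T` is a `Γ_k`-contraction: a commuting tuple having `Γ_k` as a spectral set. -/
def IsGammaContraction {k : ℕ} (T : Fin k → (H →L[ℂ] H)) : Prop :=
  (∀ i j, Commute (T i) (T j)) ∧
  taylorSpectrum T ⊆ closedSymDisc k ∧
  ∀ f : MvPolynomial (Fin k) ℂ,
    ‖polyEval T f‖ ≤ sSup ((fun s => ‖MvPolynomial.eval s f‖) '' closedSymDisc k)

variable [CompleteSpace H]

/-- `P` is a pure contraction: `‖P‖ ≤ 1` and `P*^k → 0` strongly. -/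
def IsPureContraction (P : H →L[ℂ] H) : Prop :=
  ‖P‖ ≤ 1 ∧ ∀ h : H, Filter.Tendsto (fun k : ℕ => (adjoint P ^ k) h) Filter.atTop (nhds 0)

/-- The defect operator `D_P = (I - P* P)^{1/2}` of a contraction `P`. -/
def defect (P : H →L[ℂ] H) : H →L[ℂ] H :=
  CFC.sqrt (1 - adjoint P * P)

/-- The defect space `𝒟_P`, the closure of the range of `D_P`. -/
def defectSpace (P : H →L[ℂ] H) : Submodule ℂ H :=
  (LinearMap.range (defect P : H →ₗ[ℂ] H)).topologicalClosure

instance (P : H →L[ℂ] H) : CompleteSpace (defectSpace P) :=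
  inferInstanceAs (CompleteSpace (LinearMap.range (defect P : H →ₗ[ℂ] H)).topologicalClosure)

theorem defect_mem (P : H →L[ℂ] H) (h : H) : defect P h ∈ defectSpace P :=
  Submodule.le_topologicalClosure _ (LinearMap.mem_range_self _ h)

/-- `D_P` as an operator from `H` into `𝒟_P`. -/
def defectMap (P : H →L[ℂ] H) : H →L[ℂ] defectSpace P :=
  (defect P).codRestrict (defectSpace P) (defect_mem P)

/-- `(F_1, …, F_m)` on `𝒟_P` is the fundamental operator tuple of `(S_1, …, S_m, P)`, `m = n - 1`:
`S_i - S_{n-i}* P = D_P F_i D_P` for `i = 1, …, n - 1`. With zero-based indices, the index of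
`S_{n-i}` is `Fin.rev` of the index of `S_i`. -/
def IsFundamentalTuple {m : ℕ} (S : Fin m → (H →L[ℂ] H)) (P : H →L[ℂ] H)
    (F : Fin m → (defectSpace P →L[ℂ] defectSpace P)) : Prop :=
  ∀ i, S i - adjoint (S i.rev) ∘L P =
    defect P ∘L (defectSpace P).subtypeL ∘L F i ∘L defectMap P

theorem mul_cfc_sqrt {A : Type*} [CStarAlgebra A] {x a b : A} (ha : IsSelfAdjoint a)
    (hb : IsSelfAdjoint b) (h : x * a = b * x) :
    x * cfc Real.sqrt a = cfc Real.sqrt b * x := by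
  have hp : ∀ p : Polynomial ℝ, x * Polynomial.aeval a p = Polynomial.aeval b p * x := by
    intro p
    induction p using Polynomial.induction_on' with
    | add p q hp hq => simp [mul_add, add_mul, hp, hq]
    | monomial k c =>
      have hk : x * a ^ k = b ^ k * x := (SemiconjBy.pow_right (show SemiconjBy x a b from h) k)
      simp only [Polynomial.aeval_monomial]
      rw [← mul_assoc, ← Algebra.commutes, mul_assoc, hk, mul_assoc]
  obtain ⟨R, hR⟩ : ∃ R : ℝ, ∀ c ∈ spectrum ℝ a ∪ spectrum ℝ b, c ∈ Set.Icc (-R) R := by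
    have hc : IsCompact (spectrum ℝ a ∪ spectrum ℝ b) :=
      (ContinuousFunctionalCalculus.isCompact_spectrum a).union
        (ContinuousFunctionalCalculus.isCompact_spectrum b)
    obtain ⟨R, hR⟩ := hc.isBounded.subset_closedBall 0
    refine ⟨R, fun c hc => ?_⟩
    have := hR hc
    rw [Real.closedBall_eq_Icc] at this
    simpa using this
  rw [← sub_eq_zero, ← norm_le_zero_iff]
  refine le_of_forall_pos_le_add fun ε hε => ?_
  set δ := ε / (2 * (‖x‖ + 1)) with hδ
  have hδ0 : 0 < δ := by positivity
  obtain ⟨p, hpn⟩ := exists_polynomial_near_of_continuousOn (-R) R Real.sqrt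
    Real.continuous_sqrt.continuousOn δ hδ0
  have key : ∀ c : A, IsSelfAdjoint c → (∀ y ∈ spectrum ℝ c, y ∈ Set.Icc (-R) R) →
      ‖Polynomial.aeval c p - cfc Real.sqrt c‖ ≤ δ := by
    intro c hc hy
    rw [← cfc_polynomial p c hc, ← cfc_sub (fun y => p.eval y) Real.sqrt c
      (p.continuous.continuousOn) Real.continuous_sqrt.continuousOn]
    exact norm_cfc_le hδ0.le fun y hyc => (hpn y (hy y hyc)).le
  have k1 := key a ha fun y hy => hR y (Or.inl hy)
  have k2 := key b hb fun y hy => hR y (Or.inr hy)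
  have e : x * cfc Real.sqrt a - cfc Real.sqrt b * x =
      (Polynomial.aeval b p - cfc Real.sqrt b) * x
        - x * (Polynomial.aeval a p - cfc Real.sqrt a) := by
    rw [sub_mul, mul_sub, hp p]; abel
  rw [e]
  calc _ ≤ ‖Polynomial.aeval b p - cfc Real.sqrt b‖ * ‖x‖
        + ‖x‖ * ‖Polynomial.aeval a p - cfc Real.sqrt a‖ :=
        (norm_sub_le _ _).trans (add_le_add (norm_mul_le _ _) (norm_mul_le _ _))
    _ ≤ δ * ‖x‖ + ‖x‖ * δ := by gcongr
    _ ≤ δ * (2 * (‖x‖ + 1)) := by nlinarith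
    _ = 0 + ε := by rw [hδ]; field_simp; ring

theorem one_sub_nonneg_iff (P : H →L[ℂ] H) : 0 ≤ 1 - adjoint P * P ↔ ‖P‖ ≤ 1 := by
  rw [sub_nonneg, ← star_eq_adjoint,
    ← CStarAlgebra.norm_le_one_iff_of_nonneg _ (star_mul_self_nonneg P),
    CStarRing.norm_star_mul_self]
  exact ⟨fun h => by nlinarith [norm_nonneg P], fun h => by nlinarith [norm_nonneg P]⟩

/-- `P D_P = D_{P*} P`. -/
theorem mul_defect (P : H →L[ℂ] H) : P * defect P = defect (adjoint P) * P := by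
  unfold defect
  by_cases h : ‖P‖ ≤ 1
  · have h1 : 0 ≤ 1 - adjoint P * P := (one_sub_nonneg_iff P).2 h
    have h2 : 0 ≤ 1 - adjoint (adjoint P) * adjoint P :=
      (one_sub_nonneg_iff (adjoint P)).2 (by simpa using h)
    rw [CFC.sqrt_eq_real_sqrt _ h1, CFC.sqrt_eq_real_sqrt _ h2, cfcₙ_eq_cfc, cfcₙ_eq_cfc]
    exact mul_cfc_sqrt (.of_nonneg h1) (.of_nonneg h2) (by
      rw [adjoint_adjoint, mul_sub, sub_mul, mul_one, one_mul, mul_assoc])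
  · have h1 : ¬ 0 ≤ 1 - adjoint P * P := fun h' => h ((one_sub_nonneg_iff P).1 h')
    have h2 : ¬ 0 ≤ 1 - adjoint (adjoint P) * adjoint P := fun h' =>
      h (by simpa using (one_sub_nonneg_iff (adjoint P)).1 h')
    rw [CFC.sqrt, CFC.sqrt, cfcₙ_apply_of_not_predicate _ h1, cfcₙ_apply_of_not_predicate _ h2]
    simp

/-- `-P + z D_{P*} (I - z P*)⁻¹ D_P` maps `𝒟_P` into `𝒟_{P*}`. -/
theorem charFun_mem (P : H →L[ℂ] H) (z : ℂ) (ξ : defectSpace P) :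
    ((-P + z • (defect (adjoint P) ∘L Ring.inverse (1 - z • adjoint P) ∘L defect P)) ∘L
      (defectSpace P).subtypeL) ξ ∈ defectSpace (adjoint P) := by
  have hP : ∀ x ∈ defectSpace P, P x ∈ defectSpace (adjoint P) := by
    intro x hx
    have hs : IsClosed ((defectSpace (adjoint P) : Set H)) :=
      Submodule.isClosed_topologicalClosure _
    refine closure_minimal (t := P ⁻¹' (defectSpace (adjoint P) : Set H)) ?_
      (hs.preimage P.continuous) hx
    rintro _ ⟨y, rfl⟩
    have := congrArg (fun T : H →L[ℂ] H => T y) (mul_defect P)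
    change P (defect P y) ∈ defectSpace (adjoint P)
    rw [show P (defect P y) = defect (adjoint P) (P y) from this]
    exact defect_mem _ _
  exact Submodule.add_mem _ (Submodule.neg_mem _ (hP _ ξ.2))
    (Submodule.smul_mem _ _ (defect_mem _ _))

/-- The Sz.-Nagy–Foias characteristic function
`Θ_P(z) = [-P + z D_{P*} (I - z P*)⁻¹ D_P] |_{𝒟_P} : 𝒟_P → 𝒟_{P*}` of a contraction `P`
(`I - z P*` is invertible for `|z| < 1`). -/
def charFun (P : H →L[ℂ] H) (z : ℂ) : defectSpace P →L[ℂ] defectSpace (adjoint P) :=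
  ((-P + z • (defect (adjoint P) ∘L Ring.inverse (1 - z • adjoint P) ∘L defect P)) ∘L
    (defectSpace P).subtypeL).codRestrict (defectSpace (adjoint P)) (charFun_mem P z)

/-- For operators `F_1, …, F_m` and `n = m + 1`, the tuple whose `i`-th entry is
`((n - i) / n) (F_i* + z F_{n-i})`, `i = 1, …, n - 1`. (The zero-based index `k` is `i - 1`, so
`n - i = m - k`.) -/
def weightedPencil {m : ℕ} (F : Fin m → (H →L[ℂ] H)) (z : ℂ) : Fin m → (H →L[ℂ] H) :=
  fun k => (((m : ℂ) - (k.val : ℂ)) / ((m : ℂ) + 1)) • (adjoint (F k) + z • F k.rev)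

end Operators

end SymPolydisc

end

open SymPolydisc

/-!
Throughout, `n = m + 1`. Part (a) is algebra in the defect colligation of `P`: the operators `P`,
`D_P`, `D_{P*}` and `P|𝒟_P` are the blocks of a unitary, and `Θ_P` is its transfer function. The
fundamental equations then give `P A_i = B_i* P` on `𝒟_P`, `D_P A_i = S_i D_P - D_{P*} B_{n-i} P`
and `B_{n-i} D_{P*} + B_i* D_{P*} P* = D_{P*} S_{n-i}*`, and multiplying out the two sides of the
intertwining relation with the help of these identities shows that they agree
(`IsDefectColligation.pencil_charFun`).

For part (b), the model map `W h = ∑ zⁿ D_{P*} P*ⁿ h` embeds `H` isometrically into the Hardy space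
`ℓ²(ℕ, 𝒟_{P*})`, because `P` is pure, and `P = W* M_z W`. Let `T_i` be the Toeplitz operator with
symbol `B_i* + z B_{n-i}` and put `S_i = W* T_i W`. The orthogonal complement of `Ran W` is the
closed span of the `zⁿ Θ_P x`, and the intertwining relation says precisely that `T_i` maps `Θ_P x`
to `Θ_P (A_i x) + z Θ_P (A_{n-i}* x)`; so it leaves this complement invariant, `W* T_i = S_i W*`,
and every polynomial in `(S, P)` is a compression of the same polynomial in `(T, M_z)`. Three
points remain.

* *`Γ_n` is a spectral set of `(T, M_z)`.* At a point `ω` of the circle the symbols are commuting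
  normal operators with `N_i* = conj ω N_{n-i}`. A character of the commutative C*-algebra that they
  generate sends the weighted tuple into `Γ_{n-1}`, by polynomial convexity of `Γ_{n-1}`
  (`mem_closedSymDisc_of_hull`), and therefore `(N, ω)` into `Γ_n`, by Cohn's theorem on the zeros of
  self-inversive polynomials (`snoc_mem_closedSymDisc`). This bounds polynomials in the symbols
  (`norm_polyEval_snoc_le`), and Parseval's identity over the roots of unity carries the bound over
  to the Toeplitz operators (`SeqSpace.norm_polyEval_toeplitz_le`). Averaging over roots of unity
  replaces integration over the circle.
* *The Taylor spectrum lies in `Γ_n`.* A point outside `Γ_n` is separated from it by a polynomial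
  `f`; then `f(T) - f(lam)` is invertible and equals `∑ (T_i - lam_i) g_i(T)`, which gives a null
  homotopy of the Koszul complex (`taylorSpectrum_subset`).
* *The fundamental equations.* The one for `B` is a computation with the shift
  (`IsDefectColligation.fundamental_compress`). The one for `A` follows from it and the Taylor
  coefficients of the intertwining relation (`IsDefectColligation.fundamental_of_coefficients`).
-/

open scoped InnerProduct

namespace SymPolydisc

/-! ### The defect colligation of a contraction -/

section Colligation

variable {H E F : Type*}
  [NormedAddCommGroup H] [InnerProductSpace ℂ H] [CompleteSpace H]
  [NormedAddCommGroup E] [InnerProductSpace ℂ E] [CompleteSpace E]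
  [NormedAddCommGroup F] [InnerProductSpace ℂ F] [CompleteSpace F]

/-- The relations between a contraction `P`, its two defect operators `d : H → 𝒟_P` and
`e : H → 𝒟_{P*}`, and the restriction `p : 𝒟_P → 𝒟_{P*}` of `P`. Those without density say that
the block operator with rows `(P, (e†))` and `(d, -(p†))` is unitary. -/
structure IsDefectColligation (P : H →L[ℂ] H) (d : H →L[ℂ] E) (e : H →L[ℂ] F)
    (p : E →L[ℂ] F) : Prop where
  adj_d_d : ∀ h, (d†) (d h) = h - (P†) (P h)
  adj_e_e : ∀ h, (e†) (e h) = h - P ((P†) h)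
  d_adj_d : ∀ x, d ((d†) x) = x - (p†) (p x)
  e_adj_e : ∀ y, e ((e†) y) = y - p ((p†) y)
  p_d : ∀ h, p (d h) = e (P h)
  adj_p_e : ∀ h, (p†) (e h) = d ((P†) h)
  adj_e_p : ∀ x, (e†) (p x) = P ((d†) x)
  adj_d_p : ∀ y, (d†) ((p†) y) = (P†) ((e†) y)
  dense_d : DenseRange d
  dense_e : DenseRange e

omit [CompleteSpace H] [CompleteSpace E] in
theorem eq_of_comp_denseRange {X : Type*} [NormedAddCommGroup X] [InnerProductSpace ℂ X]
    {d : H →L[ℂ] E} (hd : DenseRange d) {S T : E →L[ℂ] X} (h : ∀ x, S (d x) = T (d x)) :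
    S = T :=
  DFunLike.coe_injective (hd.equalizer S.continuous T.continuous (funext h))

theorem adjoint_injective_of_denseRange {d : H →L[ℂ] E} (hd : DenseRange d) :
    Function.Injective (d†) := by
  intro x y h
  have h0 : ∀ z, inner ℂ (x - y) z = (0 : ℂ) := by
    intro z
    refine congrFun (DenseRange.equalizer (g := fun z => inner ℂ (x - y) z)
      (h := fun _ => (0 : ℂ)) hd (by fun_prop) (by fun_prop) (funext fun w => ?_)) z
    change inner ℂ (x - y) (d w) = 0
    rw [← adjoint_inner_left, map_sub, h, sub_self, inner_zero_left]
  exact sub_eq_zero.1 (inner_self_eq_zero.1 (h0 _))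

namespace IsDefectColligation

variable {P : H →L[ℂ] H} {d : H →L[ℂ] E} {e : H →L[ℂ] F} {p : E →L[ℂ] F}
  {S T : H →L[ℂ] H} {A A' : E →L[ℂ] E} {B B' : F →L[ℂ] F}

theorem adj_e_injective (c : IsDefectColligation P d e p) : Function.Injective (e†) :=
  adjoint_injective_of_denseRange c.dense_e

/-- `P A_i = B_i* P` on `𝒟_P`, where `S = S_i` and `T = S_{n-i}`. -/
theorem p_comp_A (c : IsDefectColligation P d e p) (hSP : ∀ h, S (P h) = P (S h))
    (hA : ∀ h, (d†) (A (d h)) = S h - (T†) (P h))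
    (hB : ∀ h, (e†) (B (e h)) = (S†) h - T ((P†) h)) (x : E) : p (A x) = (B†) (p x) := by
  have hB' : ∀ h, (e†) ((B†) (e h)) = S h - P ((T†) h) := by
    have key : (e†) ∘L B ∘L e = (S†) - T ∘L (P†) := ContinuousLinearMap.ext hB
    intro h
    have := congrArg (fun X : H →L[ℂ] H => (X†) h) key
    simpa [adjoint_comp, map_sub] using this
  refine DFunLike.congr_fun (f := p ∘L A) (g := (B†) ∘L p)
    (eq_of_comp_denseRange c.dense_d fun h => c.adj_e_injective ?_) x
  change (e†) (p (A (d h))) = (e†) ((B†) (p (d h)))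
  rw [c.adj_e_p, hA, c.p_d, hB', map_sub, hSP]

/-- `D_P A_i = S_i D_P - D_{P*} B_{n-i} P` on `𝒟_P`. -/
theorem adj_d_comp_A (c : IsDefectColligation P d e p)
    (hA : ∀ h, (d†) (A (d h)) = S h - (T†) (P h))
    (hB' : ∀ h, (e†) (B' (e h)) = (T†) h - S ((P†) h)) (x : E) :
    (d†) (A x) = S ((d†) x) - (e†) (B' (p x)) := by
  refine DFunLike.congr_fun (f := (d†) ∘L A) (g := S ∘L (d†) - (e†) ∘L B' ∘L p)
    (eq_of_comp_denseRange c.dense_d fun h => ?_) x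
  change (d†) (A (d h)) = S ((d†) (d h)) - (e†) (B' (p (d h)))
  rw [hA, c.adj_d_d, c.p_d, hB', map_sub]
  abel

/-- `B_{n-i} D_{P*} + B_i* D_{P*} P* = D_{P*} S_{n-i}*`. -/
theorem B_comp_e (c : IsDefectColligation P d e p) (hTP : ∀ h, T (P h) = P (T h))
    (hB : ∀ h, (e†) (B (e h)) = (S†) h - T ((P†) h))
    (hB' : ∀ h, (e†) (B' (e h)) = (T†) h - S ((P†) h)) (h : H) :
    B' (e h) + (B†) (e ((P†) h)) = e ((T†) h) := by
  have hB2 : ∀ h, (e†) ((B†) (e h)) = S h - P ((T†) h) := by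
    have key : (e†) ∘L B ∘L e = (S†) - T ∘L (P†) := ContinuousLinearMap.ext hB
    intro h
    have := congrArg (fun X : H →L[ℂ] H => (X†) h) key
    simpa [adjoint_comp, map_sub] using this
  have hc : (T†) ((P†) h) = (P†) ((T†) h) := by
    have key : T ∘L P = P ∘L T := ContinuousLinearMap.ext hTP
    have := congrArg (fun X : H →L[ℂ] H => (X†) h) key
    simpa [adjoint_comp] using this.symm
  apply c.adj_e_injective
  rw [map_add, hB', hB2, c.adj_e_e, hc]
  abel

/-- The defect colligation of `P*`. -/
theorem symm (c : IsDefectColligation P d e p) : IsDefectColligation (P†) e d (p†) where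
  adj_d_d h := by rw [adjoint_adjoint]; exact c.adj_e_e h
  adj_e_e h := by rw [adjoint_adjoint]; exact c.adj_d_d h
  d_adj_d h := by rw [adjoint_adjoint]; exact c.e_adj_e h
  e_adj_e h := by rw [adjoint_adjoint]; exact c.d_adj_d h
  p_d := c.adj_p_e
  adj_p_e h := by rw [adjoint_adjoint, adjoint_adjoint]; exact c.p_d h
  adj_e_p := c.adj_d_p
  adj_d_p h := by rw [adjoint_adjoint, adjoint_adjoint]; exact c.adj_e_p h
  dense_d := c.dense_e
  dense_e := c.dense_d

end IsDefectColligation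

theorem adjoint_apply_comm {S P : H →L[ℂ] H} (h : ∀ x, S (P x) = P (S x)) (x : H) :
    (S†) ((P†) x) = (P†) ((S†) x) := by
  have key : S ∘L P = P ∘L S := ContinuousLinearMap.ext h
  have := congrArg (fun X : H →L[ℂ] H => (X†) x) key
  simpa [adjoint_comp] using this.symm

/-- The characteristic function intertwines the pencils of two fundamental operator tuples.
Here `R = (1 - zP*)⁻¹`, `S = S_i`, `T = S_{n-i}`, and a prime marks the index `n - i`. -/
theorem IsDefectColligation.pencil_charFun
    {P : H →L[ℂ] H} {d : H →L[ℂ] E} {e : H →L[ℂ] F} {p : E →L[ℂ] F}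
    {S T : H →L[ℂ] H} {A A' : E →L[ℂ] E} {B B' : F →L[ℂ] F}
    (c : IsDefectColligation P d e p)
    (hSP : ∀ h, S (P h) = P (S h)) (hTP : ∀ h, T (P h) = P (T h))
    (hA : ∀ h, (d†) (A (d h)) = S h - (T†) (P h)) (hA' : ∀ h, (d†) (A' (d h)) = T h - (S†) (P h))
    (hB : ∀ h, (e†) (B (e h)) = (S†) h - T ((P†) h))
    (hB' : ∀ h, (e†) (B' (e h)) = (T†) h - S ((P†) h))
    {z : ℂ} {R : H →L[ℂ] H} (hR : ∀ h, R h - z • (P†) (R h) = h)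
    (hR' : ∀ h, R h - z • R ((P†) h) = h) (x : E) :
    (B†) (-p x + z • e (R ((d†) x))) + z • B' (-p x + z • e (R ((d†) x))) =
      -p (A x + z • (A'†) x) + z • e (R ((d†) (A x + z • (A'†) x))) := by
  have hcT := adjoint_apply_comm hTP
  have hcS := adjoint_apply_comm hSP
  have h0 := c.p_comp_A hSP hA hB
  -- `z B' e R = z e (T†) R - z (B†) e (P†) R` and `z (P†) R = R - 1`
  have h1 : ∀ h, (B†) (e (R h)) + z • B' (e (R h)) = (B†) (e h) + z • e ((T†) (R h)) := by
    intro h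
    have := c.B_comp_e hTP hB hB' (R h)
    have hz : (B†) (e (R h)) - z • (B†) (e ((P†) (R h))) = (B†) (e h) := by
      rw [← map_smul, ← map_smul, ← map_sub, ← map_sub, hR]
    rw [← this, ← hz, smul_add]
    abel
  have h2 : ∀ x, (d†) ((A'†) x) = (T†) ((d†) x) - (P†) ((d†) (A x)) := by
    have hsym : A' ∘L d + A† ∘L d ∘L P = d ∘L T := by
      ext h
      simpa [adjoint_adjoint] using c.symm.B_comp_e (S := S†) (T := T†) (B := A) (B' := A')
        hcT (by simpa [adjoint_adjoint] using hA) (by simpa [adjoint_adjoint] using hA') h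
    intro x
    have := congrArg (fun X => (X†) x) hsym
    simp only [map_add, adjoint_comp, adjoint_adjoint, add_apply, comp_apply] at this
    rw [← this]
    abel
  have hRT : ∀ h, R ((T†) h) = (T†) (R h) := by
    intro h
    conv_lhs => rw [← hR h]
    rw [map_sub, map_smul, hcT, map_sub, map_smul, hR']
  have h3 : ∀ h, (B†) (e h) = e (S h) - p ((A'†) (d h)) := by
    have key : e† ∘L B = S† ∘L e† - d† ∘L A' ∘L p† := by
      ext y
      exact c.symm.adj_d_comp_A (S := S†) (T := T†) (A := B) (B' := A')
        (by simpa [adjoint_adjoint] using hB) (by simpa [adjoint_adjoint] using hA') y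
    intro h
    have := congrArg (fun X => (X†) h) key
    simpa [map_sub, adjoint_comp] using this
  have h4 : ∀ y, (A'†) ((p†) y) = (p†) (B' y) := by
    have key : p ∘L A' = B'† ∘L p := by
      ext x
      exact c.p_comp_A hTP hA' hB' x
    intro y
    have := congrArg (fun X => (X†) y) key
    simpa [adjoint_comp] using this
  -- the Taylor coefficient of order one
  have hone : (B†) (e ((d†) x)) - B' (p x) = e ((d†) (A x)) - p ((A'†) x) := by
    rw [h3, c.d_adj_d, c.adj_d_comp_A hA hB', map_sub, map_sub, map_sub, h4, c.e_adj_e]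
    abel
  have hL : (B†) (-p x + z • e (R ((d†) x))) + z • B' (-p x + z • e (R ((d†) x))) =
      -p (A x) + z • ((B†) (e ((d†) x)) - B' (p x)) + z • z • e ((T†) (R ((d†) x))) := by
    have := h1 ((d†) x)
    have hz := congrArg (fun y => z • y) this
    simp only [smul_add] at hz
    simp only [map_add, map_neg, map_smul, smul_add, smul_neg, smul_sub, h0]
    rw [add_assoc (-(B†) (p x)), add_left_comm (z • (B†) (e (R ((d†) x)))), hz]
    abel
  rw [hL, hone]
  have hu := hR' ((d†) (A x))
  have hd : R ((d†) (A x + z • (A'†) x)) = (d†) (A x) + z • (T†) (R ((d†) x)) := by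
    rw [map_add, map_smul, h2, map_add, map_smul, map_sub, hRT]
    conv_rhs => rw [← hu]
    rw [smul_sub]
    abel
  rw [hd]
  simp only [map_add, map_smul, smul_add, smul_sub, neg_add]
  abel

/-- The `A`-side fundamental equation follows from the `B`-side
one, the first two Taylor coefficients of the intertwining relation, and the relation
`D_P S_i = A_i D_P + A_{n-i}* D_P P`. With `X = S - T† P - d† A d` and `X'` its counterpart for the
index `n - i`, one finds `P X = 0`, `X' = -X† P` and `(1 - P P†) X = P X'†`, whence `X = 0`. -/
theorem IsDefectColligation.fundamental_of_coefficients
    {P : H →L[ℂ] H} {d : H →L[ℂ] E} {e : H →L[ℂ] F} {p : E →L[ℂ] F}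
    {S T : H →L[ℂ] H} {A A' : E →L[ℂ] E} {B B' : F →L[ℂ] F}
    (c : IsDefectColligation P d e p)
    (hSP : ∀ h, S (P h) = P (S h)) (hTP : ∀ h, T (P h) = P (T h))
    (hB : ∀ h, (e†) (B (e h)) = (S†) h - T ((P†) h))
    (hB' : ∀ h, (e†) (B' (e h)) = (T†) h - S ((P†) h))
    (h0 : ∀ x, p (A x) = (B†) (p x)) (h0' : ∀ x, p (A' x) = (B'†) (p x))
    (hone : ∀ x, (B†) (e ((d†) x)) - B' (p x) = e ((d†) (A x)) - p ((A'†) x))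
    (hS : ∀ h, d (S h) = A (d h) + (A'†) (d (P h)))
    (hT : ∀ h, d (T h) = A' (d h) + (A†) (d (P h))) (h : H) :
    (d†) (A (d h)) = S h - (T†) (P h) := by
  -- facts valid for both indices
  have aux : ∀ {S T : H →L[ℂ] H} {A A' : E →L[ℂ] E} {B : F →L[ℂ] F},
      (∀ h, S (P h) = P (S h)) →
      (∀ h, (e†) (B (e h)) = (S†) h - T ((P†) h)) →
      (∀ x, p (A x) = (B†) (p x)) →
      (∀ h, d (S h) = A (d h) + (A'†) (d (P h))) →
      (∀ h, P ((S - T† ∘L P - d† ∘L A ∘L d) h) = 0) ∧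
      (∀ h, (S - T† ∘L P - d† ∘L A ∘L d) h = -((T - S† ∘L P - d† ∘L A' ∘L d)†) (P h)) := by
    intro S T A A' B hSP hB h0 hS
    have hBa : ∀ h, (e†) ((B†) (e h)) = S h - P ((T†) h) := by
      have key : e† ∘L B ∘L e = S† - T ∘L P† := ContinuousLinearMap.ext hB
      intro h
      have := congrArg (fun X : H →L[ℂ] H => (X†) h) key
      simpa [adjoint_comp, map_sub] using this
    have hPX : ∀ h, P ((S - T† ∘L P - d† ∘L A ∘L d) h) = 0 := by
      intro h
      simp only [sub_apply, comp_apply, map_sub]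
      rw [← c.adj_e_p, h0, c.p_d, hBa, hSP]
      abel
    refine ⟨hPX, fun h => ?_⟩
    have hdX : d ((S - T† ∘L P - d† ∘L A ∘L d) h) =
        -(d ((T†) (P h)) - (A'†) (d (P h)) - (p†) ((B†) (e (P h)))) := by
      simp only [sub_apply, comp_apply, map_sub]
      rw [hS, c.d_adj_d, h0, c.p_d]
      abel
    have hZ : (d†) (d ((T†) (P h)) - (A'†) (d (P h)) - (p†) ((B†) (e (P h)))) =
        ((T - S† ∘L P - d† ∘L A' ∘L d)†) (P h) := by
      simp only [map_sub, adjoint_comp, adjoint_adjoint, sub_apply, comp_apply]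
      rw [c.adj_d_d, c.adj_d_p, hBa, map_sub]
      abel
    have := c.adj_d_d ((S - T† ∘L P - d† ∘L A ∘L d) h)
    rw [hPX, map_zero, sub_zero, hdX, map_neg, hZ] at this
    exact this.symm
  obtain ⟨hPX, hXX⟩ := aux hSP hB h0 hS
  obtain ⟨hPX', hXX'⟩ := aux hTP hB' h0' hT
  set X := S - T† ∘L P - d† ∘L A ∘L d with hX
  set X' := T - S† ∘L P - d† ∘L A' ∘L d with hX'
  have hX'a : ∀ h, (X'†) h = -(P†) (X h) := by
    have key : X' = -(X† ∘L P) := ContinuousLinearMap.ext hXX'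
    intro h
    have := congrArg (fun Y : H →L[ℂ] H => (Y†) h) key
    simpa [adjoint_comp] using this
  have hX'd : ∀ h, (X'†) ((d†) (d h)) = (X'†) h := by
    have key : d† ∘L d ∘L X' = X' := by
      ext h
      simp only [comp_apply]
      rw [c.adj_d_d, hPX', map_zero, sub_zero]
    intro h
    have := congrArg (fun Y : H →L[ℂ] H => (Y†) h) key
    simpa [adjoint_comp] using this
  have hBa : ∀ h, (e†) ((B†) (e h)) = S h - P ((T†) h) := by
    have key : e† ∘L B ∘L e = S† - T ∘L P† := ContinuousLinearMap.ext hB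
    intro h
    have := congrArg (fun X : H →L[ℂ] H => (X†) h) key
    simpa [adjoint_comp, map_sub] using this
  have h4 : ∀ y, (A'†) ((p†) y) = (p†) (B' y) := by
    have key : p ∘L A' = B'† ∘L p := ContinuousLinearMap.ext h0'
    intro y
    have := congrArg (fun X => (X†) y) key
    simpa [adjoint_comp] using this
  have hXZ : X h = S ((d†) (d h)) - (d†) (A (d h)) - (e†) (B' (p (d h))) := by
    simp only [hX, sub_apply, comp_apply]
    rw [c.adj_d_d, c.p_d, hB', map_sub]
    abel
  have heX : e (X h) = e (S ((d†) (d h))) - (B†) (e ((d†) (d h))) -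
      p ((A'†) (d ((d†) (d h)))) := by
    have h1 := hone (d h)
    rw [hXZ, map_sub, map_sub, c.e_adj_e, ← h4, c.d_adj_d, map_sub, map_sub]
    rw [← sub_eq_zero] at h1 ⊢
    rw [← h1]
    abel
  have heeX : (e†) (e (X h)) = P ((X'†) h) := by
    rw [← hX'd, heX]
    simp only [hX', map_sub, adjoint_comp, adjoint_adjoint, sub_apply, comp_apply]
    rw [c.adj_e_e, hBa, c.adj_e_p]
    abel
  have hX0 : X h = 0 := by
    rw [c.adj_e_e, hX'a, map_neg] at heeX
    have := sub_eq_iff_eq_add.1 heeX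
    simpa using this
  rw [eq_comm, ← sub_eq_zero, ← hX0, hX]
  rfl

end Colligation

/-! ### The colligation of the defect operators -/

section Defect

variable {H : Type*} [NormedAddCommGroup H] [InnerProductSpace ℂ H] [CompleteSpace H]

theorem norm_adjoint_le_one {P : H →L[ℂ] H} (hP : ‖P‖ ≤ 1) : ‖P†‖ ≤ 1 := by
  simpa using hP

theorem isSelfAdjoint_defect (P : H →L[ℂ] H) : (defect P)† = defect P :=
  (IsSelfAdjoint.of_nonneg (CFC.sqrt_nonneg _)).adjoint_eq

theorem defect_mul_defect {P : H →L[ℂ] H} (hP : ‖P‖ ≤ 1) :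
    defect P * defect P = 1 - P† * P :=
  CFC.sqrt_mul_sqrt_self _ ((one_sub_nonneg_iff P).2 hP)

theorem adjoint_defectMap (P : H →L[ℂ] H) (x : defectSpace P) :
    ((defectMap P)†) x = defect P x := by
  refine ext_inner_right ℂ fun h => ?_
  rw [adjoint_inner_left, ← isSelfAdjoint_defect P, adjoint_inner_left]
  rfl

theorem denseRange_defectMap (P : H →L[ℂ] H) : DenseRange (defectMap P) := by
  intro x
  rw [closure_subtype]
  refine closure_mono ?_ x.2
  rintro _ ⟨y, rfl⟩
  exact ⟨defectMap P y, ⟨y, rfl⟩, rfl⟩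

theorem map_mem_defectSpace (P : H →L[ℂ] H) (x : defectSpace P) :
    (P ∘L (defectSpace P).subtypeL) x ∈ defectSpace (P†) := by
  -- at `z = 0` the characteristic function is `-P`
  simpa using (charFun_mem P 0 x)

/-- The restriction of `P` to an operator `𝒟_P → 𝒟_{P*}`. -/
noncomputable def defectRestrict (P : H →L[ℂ] H) : defectSpace P →L[ℂ] defectSpace (P†) :=
  (P ∘L (defectSpace P).subtypeL).codRestrict _ (map_mem_defectSpace P)

theorem defectMap_apply_map (P : H →L[ℂ] H) (h : H) :
    defectRestrict P (defectMap P h) = defectMap (P†) (P h) :=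
  Subtype.ext (DFunLike.congr_fun (mul_defect P) h)

theorem adjoint_defectRestrict (P : H →L[ℂ] H) (y : defectSpace (P†)) :
    (((defectRestrict P)†) y : H) = (P†) y := by
  have hmem : (P†) y ∈ defectSpace P := by
    simpa [adjoint_adjoint] using map_mem_defectSpace (P†) y
  have : ((defectRestrict P)†) y = ⟨(P†) y, hmem⟩ := by
    refine ext_inner_right ℂ fun x => ?_
    rw [adjoint_inner_left]
    change inner ℂ (y : H) (P x) = inner ℂ ((P†) y) (x : H)
    rw [adjoint_inner_left]
  rw [this]

theorem isDefectColligation_defect {P : H →L[ℂ] H} (hP : ‖P‖ ≤ 1) :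
    IsDefectColligation P (defectMap P) (defectMap (P†)) (defectRestrict P) := by
  have h1 : ∀ h, defect P (defect P h) = h - (P†) (P h) :=
    DFunLike.congr_fun (defect_mul_defect hP)
  have h2 : ∀ h, defect (P†) (defect (P†) h) = h - P ((P†) h) := by
    have := DFunLike.congr_fun (defect_mul_defect (norm_adjoint_le_one hP))
    rw [adjoint_adjoint] at this
    exact this
  have h3 : ∀ h, P (defect P h) = defect (P†) (P h) := DFunLike.congr_fun (mul_defect P)
  have h4 : ∀ h, (P†) (defect (P†) h) = defect P ((P†) h) := by
    have := DFunLike.congr_fun (mul_defect (P†))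
    rw [adjoint_adjoint] at this
    exact this
  refine ⟨fun h => ?_, fun h => ?_, fun x => Subtype.ext ?_, fun y => Subtype.ext ?_,
    defectMap_apply_map P, fun h => Subtype.ext ?_, fun x => ?_, fun y => ?_,
    denseRange_defectMap P, denseRange_defectMap _⟩
  · rw [adjoint_defectMap]; exact h1 h
  · rw [adjoint_defectMap]; exact h2 h
  · rw [adjoint_defectMap, Submodule.coe_sub, adjoint_defectRestrict]; exact h1 x
  · rw [adjoint_defectMap, Submodule.coe_sub]
    refine (h2 y).trans ?_
    rw [← adjoint_defectRestrict]
    rfl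
  · rw [adjoint_defectRestrict]; exact h4 h
  · rw [adjoint_defectMap, adjoint_defectMap]; exact (h3 x).symm
  · rw [adjoint_defectMap, adjoint_defectMap, adjoint_defectRestrict]; exact (h4 y).symm

theorem isUnit_one_sub_smul_adjoint {P : H →L[ℂ] H} (hP : ‖P‖ ≤ 1) {z : ℂ} (hz : ‖z‖ < 1) :
    IsUnit (1 - z • P†) := by
  refine isUnit_one_sub_of_norm_lt_one ?_
  rw [norm_smul]
  have := norm_adjoint_le_one hP
  nlinarith [norm_nonneg z, norm_nonneg (P†)]

theorem charFun_apply (P : H →L[ℂ] H) (z : ℂ) (x : defectSpace P) :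
    charFun P z x = -defectRestrict P x + z • defectMap (P†)
      (Ring.inverse (1 - z • P†) (((defectMap P)†) x)) := by
  rw [adjoint_defectMap]
  rfl

/-- The fundamental equation in terms of the defect map into `𝒟_P`. -/
theorem isFundamentalTuple_iff {m : ℕ} {S : Fin m → (H →L[ℂ] H)} {P : H →L[ℂ] H}
    {A : Fin m → (defectSpace P →L[ℂ] defectSpace P)} :
    IsFundamentalTuple S P A ↔ ∀ i h, ((defectMap P)†) (A i (defectMap P h)) =
      S i h - ((S i.rev)†) (P h) := by
  refine forall_congr' fun i => ?_
  rw [ContinuousLinearMap.ext_iff]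
  refine forall_congr' fun h => ?_
  rw [eq_comm, adjoint_defectMap]
  rfl

/-- For a commuting tuple `(S, P)` with `P` a contraction, the characteristic function of `P`
intertwines the pencils of the fundamental operator tuples of `(S, P)` and of its adjoint. -/
theorem pencil_comp_charFun {m : ℕ} {S : Fin m → (H →L[ℂ] H)} {P : H →L[ℂ] H}
    {A : Fin m → (defectSpace P →L[ℂ] defectSpace P)}
    {B : Fin m → (defectSpace (P†) →L[ℂ] defectSpace (P†))}
    (hP : ‖P‖ ≤ 1) (hSP : ∀ i, Commute (S i) P) (hA : IsFundamentalTuple S P A)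
    (hB : IsFundamentalTuple (fun i => (S i)†) (P†) B) (i : Fin m) {z : ℂ} (hz : ‖z‖ < 1) :
    (adjoint (B i) + z • B i.rev) ∘L charFun P z =
      charFun P z ∘L (A i + z • adjoint (A i.rev)) := by
  rw [isFundamentalTuple_iff] at hA hB
  simp only [adjoint_adjoint] at hB
  have hu := isUnit_one_sub_smul_adjoint hP hz
  ext1 x
  simp only [comp_apply, add_apply, smul_apply, charFun_apply]
  refine (isDefectColligation_defect hP).pencil_charFun
    (fun h => DFunLike.congr_fun (hSP i).eq h) (fun h => DFunLike.congr_fun (hSP i.rev).eq h)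
    (hA i) (fun h => by simpa using hA i.rev h) (hB i) (fun h => by simpa using hB i.rev h)
    (fun h => DFunLike.congr_fun (Ring.mul_inverse_cancel _ hu) h) (fun h => ?_) x
  have := DFunLike.congr_fun (Ring.inverse_mul_cancel _ hu) h
  simpa [mul_apply, map_sub] using this

end Defect

/-! ### Geometry of the symmetrized polydisc -/

section Geometry

open Finset Polynomial
open scoped ComplexConjugate

/-- The symmetrization map `z ↦ (e₁(z), …, e_k(z))`. -/
noncomputable def symMap {k : ℕ} (z : Fin k → ℂ) : Fin k → ℂ :=
  fun i => ∑ t ∈ powersetCard (i.val + 1) univ, ∏ j ∈ t, z j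

/-- The value at `w` of the monic polynomial with signed coefficients `s`, so that
`symPoly (symMap z) w = ∏ j, (w - z j)`. -/
noncomputable def symPoly {k : ℕ} (s : Fin k → ℂ) (w : ℂ) : ℂ :=
  w ^ k + ∑ i : Fin k, (-1) ^ (i.val + 1) * s i * w ^ (k - 1 - i.val)

theorem mem_closedSymDisc_iff {k : ℕ} {s : Fin k → ℂ} :
    s ∈ closedSymDisc k ↔ ∃ z : Fin k → ℂ, (∀ j, ‖z j‖ ≤ 1) ∧ s = symMap z := by
  simp only [closedSymDisc, symMap, Set.mem_ofPred_eq, funext_iff]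

theorem continuous_symMap {k : ℕ} : Continuous (symMap (k := k)) := by
  unfold symMap
  fun_prop

theorem isCompact_closedSymDisc (k : ℕ) : IsCompact (closedSymDisc k) := by
  have : closedSymDisc k = symMap '' (Metric.closedBall (0 : Fin k → ℂ) 1) := by
    ext s
    simp only [mem_closedSymDisc_iff, Set.mem_image, Metric.mem_closedBall, dist_zero_right,
      pi_norm_le_iff_of_nonneg zero_le_one, eq_comm]
  rw [this]
  exact (isCompact_closedBall _ _).image continuous_symMap

theorem norm_eval_le_sSup {k : ℕ} (f : MvPolynomial (Fin k) ℂ) {s : Fin k → ℂ}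
    (hs : s ∈ closedSymDisc k) :
    ‖MvPolynomial.eval s f‖ ≤ sSup ((fun s => ‖MvPolynomial.eval s f‖) '' closedSymDisc k) :=
  le_csSup ((isCompact_closedSymDisc k).bddAbove_image
    (MvPolynomial.continuous_eval f).norm.continuousOn) ⟨s, hs, rfl⟩

theorem prod_sub_eq_symPoly {k : ℕ} (z : Fin k → ℂ) (w : ℂ) :
    ∏ j, (w - z j) = symPoly (symMap z) w := by
  have h := congrArg (Polynomial.eval w)
    (Multiset.prod_X_sub_X_eq_sum_esymm (univ.val.map z))
  have e : ((univ.val.map z).map fun t => X - C t).prod = ∏ j, (X - C (z j)) := by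
    rw [Multiset.map_map]; rfl
  rw [e, eval_prod, Multiset.card_map, eval_finsetSum] at h
  simp only [eval_sub, eval_X, eval_C, eval_mul, eval_pow, eval_neg, eval_one,
    Finset.esymm_map_val] at h
  rw [h, show Multiset.card (univ : Finset (Fin k)).val = k from by simp, sum_range_succ', add_comm,
    symPoly, Finset.sum_range]
  congr 1
  · simp
  · refine sum_congr rfl fun i _ => ?_
    rw [symMap, mul_assoc, Nat.sub_sub, add_comm 1]

theorem prod_one_sub_conj_mul {k : ℕ} (z : Fin k → ℂ) {w : ℂ} (hw : w ≠ 0) :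
    ∏ j, (1 - conj (z j) * w) =
      1 + ∑ i : Fin k, (-1) ^ (i.val + 1) * conj (symMap z i) * w ^ (i.val + 1) := by
  have h := prod_sub_eq_symPoly z (conj w)⁻¹
  have h2 := congrArg (fun t => w ^ k * conj t) h
  simp only [map_prod, map_sub, map_inv₀, Complex.conj_conj, symPoly, map_add, map_pow, map_sum,
    map_mul, map_neg, map_one] at h2
  have e : w ^ k * ∏ j, (w⁻¹ - conj (z j)) = ∏ j, (1 - conj (z j) * w) := by
    rw [← Fin.prod_const, ← prod_mul_distrib]
    refine prod_congr rfl fun j _ => ?_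
    field_simp
  rw [e] at h2
  rw [h2, mul_add, mul_sum]
  congr 1
  · rw [← mul_pow, mul_inv_cancel₀ hw, one_pow]
  · refine sum_congr rfl fun i _ => ?_
    have : w ^ k = w ^ (i.val + 1) * w ^ (k - 1 - i.val) := by
      rw [← pow_add]; congr 1; have := i.2; omega
    rw [this, inv_pow]
    field_simp

theorem exists_map_univ_eq {k : ℕ} (M : Multiset ℂ) (hM : Multiset.card M = k) :
    ∃ z : Fin k → ℂ, univ.val.map z = M := by
  induction M using Quotient.inductionOn with
  | h l =>
    have hl : l.length = k := hM
    subst hl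
    exact ⟨l.get, by rw [Fin.univ_val_map, List.ofFn_get]; rfl⟩

theorem symMap_surjective {k : ℕ} : Function.Surjective (symMap (k := k)) := by
  intro s
  set q : ℂ[X] := ∑ i : Fin k, C ((-1) ^ (i.val + 1) * s i) * X ^ (k - 1 - i.val) with hq
  have hdeg : q.degree < k := by
    refine (degree_sum_le _ _).trans_lt ((Finset.sup_lt_iff (WithBot.bot_lt_coe k)).2 fun i _ => ?_)
    refine (degree_C_mul_X_pow_le _ _).trans_lt ?_
    have := i.2
    exact Nat.cast_lt.2 (by omega)
  set p : ℂ[X] := X ^ k + q with hp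
  have hmonic : p.Monic := monic_X_pow_add hdeg
  have hnat : p.natDegree = k := by
    rw [hp, natDegree_add_eq_left_of_degree_lt (by rwa [degree_X_pow]), natDegree_X_pow]
  have hcard : Multiset.card p.roots = k := by
    rw [← hnat]; exact (splits_iff_card_roots.1 (IsAlgClosed.splits p))
  obtain ⟨z, hz⟩ := exists_map_univ_eq p.roots hcard
  refine ⟨z, funext fun i => ?_⟩
  have h1 := coeff_eq_esymm_roots_of_splits (IsAlgClosed.splits p) (k := k - 1 - i.val)
    (by omega)
  have hi := i.2
  have h2 : p.coeff (k - 1 - i.val) = (-1) ^ (i.val + 1) * s i := by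
    rw [hp, coeff_add, coeff_X_pow, if_neg (by omega), zero_add, hq, finsetSum_coeff,
      Finset.sum_eq_single i]
    · rw [coeff_C_mul_X_pow, if_pos rfl]
    · intro j _ hj
      rw [coeff_C_mul_X_pow, if_neg]
      have := j.2
      intro h
      exact hj (Fin.ext (by omega))
    · simp
  rw [h2, hmonic.leadingCoeff, hnat, show k - (k - 1 - i.val) = i.val + 1 from by omega, one_mul,
    ← hz, Finset.esymm_map_val] at h1
  exact (mul_left_cancel₀ (pow_ne_zero _ (by norm_num)) h1).symm

/-- A point lies in `Γ_k` as soon as all roots of its polynomial lie in the closed disc. -/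
theorem mem_closedSymDisc_of_roots {k : ℕ} {s : Fin k → ℂ}
    (h : ∀ w, symPoly s w = 0 → ‖w‖ ≤ 1) : s ∈ closedSymDisc k := by
  obtain ⟨z, rfl⟩ := symMap_surjective s
  refine mem_closedSymDisc_iff.2 ⟨z, fun j => h _ ?_, rfl⟩
  rw [← prod_sub_eq_symPoly]
  exact prod_eq_zero (mem_univ j) (sub_self _)

/-- The elementary symmetric functions of the `N`-th powers are polynomials in those of `z`. -/
theorem exists_eval_symMap_pow {k : ℕ} (N : ℕ) (i : Fin k) :
    ∃ f : MvPolynomial (Fin k) ℂ, ∀ z : Fin k → ℂ,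
      MvPolynomial.eval (symMap z) f = symMap (fun j => z j ^ N) i := by
  have hsymm : (MvPolynomial.expand N (MvPolynomial.esymm (Fin k) ℂ (i.val + 1))) ∈
      MvPolynomial.symmetricSubalgebra (Fin k) ℂ := by
    rw [MvPolynomial.mem_symmetricSubalgebra]
    intro e
    rw [MvPolynomial.rename_expand, MvPolynomial.esymm_isSymmetric]
  obtain ⟨f, hf⟩ := MvPolynomial.esymmAlgHom_surjective (σ := Fin k) (R := ℂ) (n := k) (by simp)
    ⟨_, hsymm⟩
  refine ⟨f, fun z => ?_⟩
  have h1 : MvPolynomial.aeval (fun i : Fin k => MvPolynomial.esymm (Fin k) ℂ (i.val + 1)) f =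
      MvPolynomial.expand N (MvPolynomial.esymm (Fin k) ℂ (i.val + 1)) := by
    rw [← MvPolynomial.esymmAlgHom_apply, hf]
  have h2 := congrArg (MvPolynomial.aeval z) h1
  rw [MvPolynomial.aeval_expand, MvPolynomial.comp_aeval_apply] at h2
  have h3 : ∀ (n : ℕ) (y : Fin k → ℂ), MvPolynomial.aeval y (MvPolynomial.esymm (Fin k) ℂ n) =
      ∑ t ∈ powersetCard n univ, ∏ j ∈ t, y j := by
    intro n y
    simp [MvPolynomial.esymm]
  simp only [h3] at h2
  rw [MvPolynomial.aeval_eq_eval] at h2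
  exact h2

theorem norm_symMap_le {k : ℕ} {z : Fin k → ℂ} (hz : ∀ j, ‖z j‖ ≤ 1) (i : Fin k) :
    ‖symMap z i‖ ≤ 2 ^ k := by
  refine (norm_sum_le _ _).trans ?_
  refine (sum_le_card_nsmul _ _ 1 fun t _ => ?_).trans ?_
  · rw [norm_prod]
    exact prod_le_one (fun _ _ => norm_nonneg _) fun j _ => hz j
  · rw [card_powersetCard, nsmul_eq_mul, mul_one, card_univ, Fintype.card_fin]
    exact_mod_cast Nat.choose_le_two_pow k _

/-- A root bound: a root of a monic polynomial with small coefficients is not large. -/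
theorem norm_le_of_symPoly_eq_zero {k : ℕ} {s : Fin k → ℂ} {C : ℝ} (hs : ∀ i, ‖s i‖ ≤ C)
    {w : ℂ} (hw : symPoly s w = 0) : ‖w‖ ≤ max 1 (k * C) := by
  by_cases h1 : ‖w‖ ≤ 1
  · exact h1.trans (le_max_left _ _)
  refine le_max_of_le_right ?_
  push Not at h1
  rcases Nat.eq_zero_or_pos k with rfl | hk
  · simp [symPoly] at hw
  have h2 : ‖w ^ k‖ ≤ ∑ _i : Fin k, C * ‖w‖ ^ (k - 1) := by
    rw [eq_neg_of_add_eq_zero_left hw, norm_neg]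
    refine (norm_sum_le _ _).trans (sum_le_sum fun i _ => ?_)
    rw [norm_mul, norm_mul, norm_pow, norm_pow, norm_neg, norm_one, one_pow, one_mul]
    exact mul_le_mul (hs i) (pow_le_pow_right₀ h1.le (by omega)) (by positivity)
      ((norm_nonneg _).trans (hs i))
  rw [sum_const, card_univ, Fintype.card_fin, nsmul_eq_mul, norm_pow, ← mul_assoc] at h2
  rw [show k = (k - 1) + 1 from by omega, pow_succ', Nat.add_sub_cancel] at h2
  refine le_of_mul_le_mul_right (h2.trans_eq ?_) (pow_pos (one_pos.trans h1) (k - 1))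
  rw [Nat.sub_add_cancel hk]

/-- `Γ_k` is polynomially convex. If `s = symMap z` is in the hull, then the coefficients of
`∏ j, (w - z j ^ N)`, being polynomials in `s`, are bounded independently of `N`, hence so are
the powers of the `z j`. -/
theorem mem_closedSymDisc_of_hull {k : ℕ} {s : Fin k → ℂ}
    (h : ∀ f : MvPolynomial (Fin k) ℂ,
      ‖MvPolynomial.eval s f‖ ≤ sSup ((fun s => ‖MvPolynomial.eval s f‖) '' closedSymDisc k)) :
    s ∈ closedSymDisc k := by
  obtain ⟨z, rfl⟩ := symMap_surjective s
  refine mem_closedSymDisc_iff.2 ⟨z, fun j => ?_, rfl⟩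
  have hbound : ∀ N : ℕ, ‖z j‖ ^ N ≤ max 1 ((k : ℝ) * 2 ^ k) := by
    intro N
    rw [← norm_pow]
    refine norm_le_of_symPoly_eq_zero (s := symMap fun j => z j ^ N) (fun i => ?_) ?_
    · obtain ⟨f, hf⟩ := exists_eval_symMap_pow N i
      rw [← hf z]
      refine (h f).trans (Real.sSup_le ?_ (by positivity))
      rintro _ ⟨_, ha, rfl⟩
      obtain ⟨a, hb, rfl⟩ := mem_closedSymDisc_iff.1 ha
      change ‖MvPolynomial.eval (symMap a) f‖ ≤ _
      rw [hf a]
      exact norm_symMap_le (fun j => by rw [norm_pow]; exact pow_le_one₀ (norm_nonneg _) (hb j)) i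
    · rw [← prod_sub_eq_symPoly]
      exact prod_eq_zero (mem_univ j) (sub_self _)
  by_contra hj
  push Not at hj
  obtain ⟨N, hN⟩ := pow_unbounded_of_one_lt (max 1 ((k : ℝ) * 2 ^ k)) hj
  exact absurd (hbound N) (not_le.2 hN)

theorem norm_one_sub_conj_mul_le {a w : ℂ} (ha : ‖a‖ ≤ 1) (hw : 1 ≤ ‖w‖) :
    ‖1 - conj a * w‖ ≤ ‖w - a‖ := by
  rw [← sq_le_sq₀ (norm_nonneg _) (norm_nonneg _), ← Complex.normSq_eq_norm_sq,
    ← Complex.normSq_eq_norm_sq]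
  have h1 : Complex.normSq a ≤ 1 := by rw [Complex.normSq_eq_norm_sq]; nlinarith [norm_nonneg a]
  have h2 : 1 ≤ Complex.normSq w := by rw [Complex.normSq_eq_norm_sq]; nlinarith
  have : Complex.normSq (w - a) - Complex.normSq (1 - conj a * w) =
      (Complex.normSq w - 1) * (1 - Complex.normSq a) := by
    simp [Complex.normSq_apply]
    ring
  nlinarith [mul_nonneg (sub_nonneg.2 h2) (sub_nonneg.2 h1)]

/-- Cohn's theorem for the symmetrized polydisc. Let `p` be the polynomial of `(lam, ω)`; it is
self-inversive, and the weighted tuple belongs to `q = p' / (m + 1)`. At a root `w` of `p` outside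
the closed disc, `w q(w)` equals, up to a unimodular factor, the reversed polynomial of `q`, whose
modulus is at most `|q(w)|` because the roots of `q` lie in the closed disc. -/
theorem snoc_mem_closedSymDisc {m : ℕ} {lam : Fin m → ℂ} {ω : ℂ} (hω : ‖ω‖ = 1)
    (hself : ∀ i, lam i = conj (lam i.rev) * ω)
    (hmem : (fun i => (((m : ℂ) - (i.val : ℂ)) / ((m : ℂ) + 1)) * lam i) ∈ closedSymDisc m) :
    (Fin.snoc lam ω : Fin (m + 1) → ℂ) ∈ closedSymDisc (m + 1) := by
  obtain ⟨a, ha, hμ⟩ := mem_closedSymDisc_iff.1 hmem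
  set μ : Fin m → ℂ := fun i => (((m : ℂ) - (i.val : ℂ)) / ((m : ℂ) + 1)) * lam i with hμdef
  refine mem_closedSymDisc_of_roots fun w hw => ?_
  by_contra h1
  push Not at h1
  have hw0 : w ≠ 0 := norm_pos_iff.1 (one_pos.trans h1)
  have hm : (m : ℂ) + 1 ≠ 0 := by exact_mod_cast Nat.succ_ne_zero m
  -- `p(w) - w q(w)` is the reversed polynomial of `q`
  have hrev : symPoly (Fin.snoc lam ω : Fin (m + 1) → ℂ) w - w * symPoly μ w =
      (-1) ^ (m + 1) * ω * ∏ j, (1 - conj (a j) * w) := by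
    rw [prod_one_sub_conj_mul a hw0, ← hμ, symPoly, symPoly, Fin.sum_univ_castSucc]
    simp only [Fin.snoc_castSucc, Fin.snoc_last, Fin.val_castSucc, Fin.val_last]
    have e1 : w * (w ^ m + ∑ i : Fin m, (-1) ^ (i.val + 1) * μ i * w ^ (m - 1 - i.val)) =
        w ^ (m + 1) + ∑ i : Fin m, (-1) ^ (i.val + 1) * μ i * w ^ (m - i.val) := by
      rw [mul_add, ← pow_succ', mul_sum]
      congr 1
      refine sum_congr rfl fun i _ => ?_
      rw [show m - i.val = (m - 1 - i.val) + 1 from by have := i.2; omega, pow_succ]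
      ring
    have e2 : ∑ i : Fin m, (-1) ^ (i.val + 1) * lam i * w ^ (m + 1 - 1 - i.val) -
        ∑ i : Fin m, (-1) ^ (i.val + 1) * μ i * w ^ (m - i.val) =
        (-1) ^ (m + 1) * ω * ∑ i : Fin m, (-1) ^ (i.val + 1) * conj (μ i) * w ^ (i.val + 1) := by
      rw [← sum_sub_distrib, mul_sum, ← Equiv.sum_comp Fin.revPerm]
      refine sum_congr rfl fun i _ => ?_
      rw [Fin.revPerm_apply, hμdef]
      have hr : (i.rev.val : ℂ) = (m : ℂ) - 1 - i.val := by
        rw [Fin.val_rev, Nat.cast_sub (by have := i.2; omega)]; push_cast; ring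
      have hr' : m - i.rev.val = i.val + 1 := by rw [Fin.val_rev]; have := i.2; omega
      have hs : (-1 : ℂ) ^ (i.rev.val + 1) = (-1) ^ (m + 1) * (-1) ^ (i.val + 1) := by
        have : m + 1 + (i.val + 1) = (i.rev.val + 1) + 2 * (i.val + 1) := by
          rw [Fin.val_rev]; have := i.2; omega
        rw [← pow_add, this, pow_add _ (i.rev.val + 1), pow_mul]; simp
      simp only [map_mul, map_div₀, map_sub, map_add, map_one, Complex.conj_natCast]
      rw [hself i.rev, Fin.rev_rev, hr, hs, Nat.add_sub_cancel, hr']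
      field_simp
      ring
    rw [e1, mul_add, ← e2]
    simp only [Nat.add_sub_cancel, Nat.sub_self, pow_zero]
    ring
  rw [hw, zero_sub, hμ, ← prod_sub_eq_symPoly] at hrev
  have hnorm := congrArg norm hrev
  rw [norm_neg, norm_mul, norm_mul, norm_mul, hω, norm_pow, norm_neg, norm_one, one_pow, one_mul,
    one_mul, norm_prod, norm_prod] at hnorm
  have hle : ∏ j, ‖1 - conj (a j) * w‖ ≤ ∏ j, ‖w - a j‖ :=
    prod_le_prod (fun _ _ => norm_nonneg _) fun j _ => norm_one_sub_conj_mul_le (ha j) h1.le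
  have hpos : 0 < ∏ j, ‖w - a j‖ := by
    refine prod_pos fun j _ => norm_pos_iff.2 (sub_ne_zero.2 ?_)
    rintro rfl
    exact absurd (ha j) (not_le.2 h1)
  nlinarith

end Geometry

/-! ### Polynomials in commuting operators -/

section OrdEval

variable {k : ℕ}

/-- The value of a polynomial at a tuple of elements of an algebra, each monomial being multiplied
out in the order of the variables. -/
noncomputable def ordEval {R : Type*} [Ring R] [Algebra ℂ R] (t : Fin k → R)
    (f : MvPolynomial (Fin k) ℂ) : R :=
  ∑ d ∈ f.support, f.coeff d • (List.ofFn fun i => t i ^ d i).prod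

theorem map_ordEval {R R' : Type*} [Ring R] [Algebra ℂ R] [Ring R'] [Algebra ℂ R']
    (φ : R →ₐ[ℂ] R') (t : Fin k → R) (f : MvPolynomial (Fin k) ℂ) :
    φ (ordEval t f) = ordEval (fun i => φ (t i)) f := by
  simp only [ordEval, map_sum, map_smul, map_list_prod, List.map_ofFn, Function.comp_def, map_pow]

theorem ordEval_eq_aeval {R : Type*} [CommRing R] [Algebra ℂ R] (t : Fin k → R)
    (f : MvPolynomial (Fin k) ℂ) : ordEval t f = MvPolynomial.aeval t f := by
  rw [MvPolynomial.aeval_def, MvPolynomial.eval₂_eq', ordEval]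
  refine Finset.sum_congr rfl fun d _ => ?_
  rw [List.prod_ofFn, Algebra.smul_def]

/-- An operator intertwining two tuples of endomorphisms intertwines their polynomials, whether or
not the tuples commute. -/
theorem ordEval_intertwine {V W : Type*} [AddCommGroup V] [Module ℂ V] [AddCommGroup W]
    [Module ℂ W] (L : V →ₗ[ℂ] W) {t : Fin k → Module.End ℂ V} {t' : Fin k → Module.End ℂ W}
    (h : ∀ i v, L (t i v) = t' i (L v)) (f : MvPolynomial (Fin k) ℂ) (v : V) :
    L (ordEval t f v) = ordEval t' f (L v) := by
  have hpow : ∀ i (n : ℕ) v, L ((t i ^ n) v) = (t' i ^ n) (L v) := by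
    intro i n
    induction n with
    | zero => intro v; rfl
    | succ n ih =>
      intro v
      rw [pow_succ, pow_succ, Module.End.mul_apply, Module.End.mul_apply, ih, h]
  have hprod : ∀ (d : Fin k → ℕ) (l : List (Fin k)) v,
      L ((l.map fun i => t i ^ d i).prod v) = (l.map fun i => t' i ^ d i).prod (L v) := by
    intro d l
    induction l with
    | nil => intro v; rfl
    | cons i l ih =>
      intro v
      simp only [List.map_cons, List.prod_cons, Module.End.mul_apply, hpow, ih]
  simp only [ordEval, LinearMap.sum_apply, LinearMap.smul_apply, map_sum, map_smul,
    List.ofFn_eq_map, hprod]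

variable {H K : Type*} [NormedAddCommGroup H] [InnerProductSpace ℂ H]
  [NormedAddCommGroup K] [InnerProductSpace ℂ K]

theorem coe_polyEval (T : Fin k → (H →L[ℂ] H)) (f : MvPolynomial (Fin k) ℂ) :
    (polyEval T f : H →ₗ[ℂ] H) = ordEval (fun i => ((T i : H →ₗ[ℂ] H) : Module.End ℂ H)) f :=
  let φ : (H →L[ℂ] H) →ₐ[ℂ] Module.End ℂ H :=
    { ContinuousLinearMap.toLinearMapRingHom with commutes' := fun _ => rfl }
  map_ordEval φ T f

theorem polyEval_intertwine (L : H →L[ℂ] K) {T : Fin k → (H →L[ℂ] H)} {T' : Fin k → (K →L[ℂ] K)}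
    (h : ∀ i v, L (T i v) = T' i (L v)) (f : MvPolynomial (Fin k) ℂ) (v : H) :
    L (polyEval T f v) = polyEval T' f (L v) := by
  have := ordEval_intertwine (L : H →ₗ[ℂ] K) (t := fun i => (T i : H →ₗ[ℂ] H))
    (t' := fun i => (T' i : K →ₗ[ℂ] K)) h f v
  rw [← coe_polyEval, ← coe_polyEval] at this
  exact this

theorem continuous_polyEval {X : Type*} [TopologicalSpace X] {T : X → Fin k → (H →L[ℂ] H)}
    (hT : ∀ i, Continuous fun x => T x i) (f : MvPolynomial (Fin k) ℂ) :
    Continuous fun x => polyEval (T x) f := by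
  unfold polyEval
  refine continuous_finsetSum _ fun d _ => Continuous.fun_const_smul ?_ _
  simp only [List.ofFn_eq_map]
  exact continuous_list_prod _ fun i _ => (hT i).pow _

theorem polyEval_eq_aeval {C : Type*} [CommRing C] [Algebra ℂ C] (φ : C →ₐ[ℂ] (H →L[ℂ] H))
    (t : Fin k → C) (f : MvPolynomial (Fin k) ℂ) :
    polyEval (fun i => φ (t i)) f = φ (MvPolynomial.aeval t f) := by
  rw [← ordEval_eq_aeval, map_ordEval]
  rfl

theorem exists_algHom_of_commute {T : Fin k → (H →L[ℂ] H)} (hT : ∀ i j, Commute (T i) (T j)) :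
    ∃ Φ : MvPolynomial (Fin k) ℂ →ₐ[ℂ] (H →L[ℂ] H), (∀ f, polyEval T f = Φ f) ∧
      ∀ i, Φ (MvPolynomial.X i) = T i := by
  have hcomm := Algebra.isMulCommutative_adjoin ℂ (s := Set.range T) (by
    rintro _ ⟨i, rfl⟩ _ ⟨j, rfl⟩
    exact hT i j)
  let _ : CommRing (Algebra.adjoin ℂ (Set.range T)) :=
    { (inferInstance : Ring (Algebra.adjoin ℂ (Set.range T))) with mul_comm := mul_comm' }
  let t : Fin k → Algebra.adjoin ℂ (Set.range T) :=
    fun i => ⟨T i, Algebra.subset_adjoin ⟨i, rfl⟩⟩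
  refine ⟨(Algebra.adjoin ℂ (Set.range T)).val.comp (MvPolynomial.aeval t), fun f => ?_,
    fun i => ?_⟩
  · exact polyEval_eq_aeval (Algebra.adjoin ℂ (Set.range T)).val t f
  · rw [AlgHom.comp_apply, MvPolynomial.aeval_X]
    rfl

end OrdEval

/-! ### The Taylor spectrum of a tuple with a polynomially convex spectral set -/

section Taylor

variable {k : ℕ} {H : Type*} [NormedAddCommGroup H] [InnerProductSpace ℂ H]

theorem koszulMap_tmul (N : Fin k → (H →L[ℂ] H)) (h : H) (ξ : ExteriorAlgebra ℂ (Fin k → ℂ)) :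
    koszulMap N (h ⊗ₜ ξ) =
      ∑ i, (N i h) ⊗ₜ[ℂ] (ExteriorAlgebra.ι ℂ (Pi.single i (1 : ℂ) : Fin k → ℂ) * ξ) := by
  simp [koszulMap, LinearMap.sum_apply]

theorem koszulMap_koszulMap {N : Fin k → (H →L[ℂ] H)} (hN : ∀ i j, Commute (N i) (N j))
    (x : H ⊗[ℂ] ExteriorAlgebra ℂ (Fin k → ℂ)) : koszulMap N (koszulMap N x) = 0 := by
  induction x using TensorProduct.induction_on with
  | zero => simp
  | add x y hx hy => rw [map_add, map_add, hx, hy, add_zero]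
  | tmul h ξ =>
    simp only [koszulMap_tmul, map_sum]
    set S := ∑ j, ∑ i, (N i (N j h)) ⊗ₜ[ℂ]
      (ExteriorAlgebra.ι ℂ (Pi.single i (1 : ℂ) : Fin k → ℂ) *
        (ExteriorAlgebra.ι ℂ (Pi.single j (1 : ℂ) : Fin k → ℂ) * ξ)) with hS
    have : S = -S := by
      conv_lhs => rw [hS, Finset.sum_comm]
      rw [hS, ← Finset.sum_neg_distrib]
      refine Finset.sum_congr rfl fun j _ => ?_
      rw [← Finset.sum_neg_distrib]
      refine Finset.sum_congr rfl fun i _ => ?_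
      have h1 : N j (N i h) = N i (N j h) := DFunLike.congr_fun (hN j i).eq h
      rw [h1, ← TensorProduct.tmul_neg, ← mul_assoc, ← mul_assoc, ← neg_mul]
      rw [eq_neg_of_add_eq_zero_left (ExteriorAlgebra.ι_add_mul_swap _ _)]
    have h2 : (2 : ℂ) • S = 0 := by rw [two_smul]; nth_rw 1 [this]; exact neg_add_cancel S
    rw [← inv_smul_smul₀ (two_ne_zero (α := ℂ)) S, h2, smul_zero]

/-- A Bezout relation `∑ N_i G_i = 1` makes the Koszul complex of `N` exact: contraction with the
`G_i` is a null homotopy of the identity. -/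
theorem range_koszulMap_eq_ker {N G : Fin k → (H →L[ℂ] H)} (hN : ∀ i j, Commute (N i) (N j))
    (hNG : ∀ i j, Commute (N i) (G j)) (hsum : ∑ i, N i * G i = 1) :
    LinearMap.range (koszulMap N) = LinearMap.ker (koszulMap N) := by
  let c : Fin k → ExteriorAlgebra ℂ (Fin k → ℂ) →ₗ[ℂ] ExteriorAlgebra ℂ (Fin k → ℂ) :=
    fun j => CliffordAlgebra.contractLeft (Q := (0 : QuadraticForm ℂ (Fin k → ℂ)))
      (LinearMap.proj j : (Fin k → ℂ) →ₗ[ℂ] ℂ)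
  have hc : ∀ i j ξ, c j (ExteriorAlgebra.ι ℂ (Pi.single i (1 : ℂ) : Fin k → ℂ) * ξ) =
      (if i = j then (1 : ℂ) else 0) • ξ -
        ExteriorAlgebra.ι ℂ (Pi.single i (1 : ℂ) : Fin k → ℂ) * c j ξ := by
    intro i j ξ
    have := CliffordAlgebra.contractLeft_ι_mul (Q := (0 : QuadraticForm ℂ (Fin k → ℂ)))
      (d := (LinearMap.proj j : (Fin k → ℂ) →ₗ[ℂ] ℂ)) (Pi.single i 1) ξ
    refine this.trans ?_
    congr 2
    simp [Pi.single_apply, eq_comm]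
  let s : (H ⊗[ℂ] ExteriorAlgebra ℂ (Fin k → ℂ)) →ₗ[ℂ]
      (H ⊗[ℂ] ExteriorAlgebra ℂ (Fin k → ℂ)) :=
    ∑ j, TensorProduct.map (G j : H →ₗ[ℂ] H) (c j)
  have hs : ∀ h ξ, s (h ⊗ₜ ξ) = ∑ j, (G j h) ⊗ₜ[ℂ] (c j ξ) := by
    intro h ξ
    simp [s, LinearMap.sum_apply]
  have hhom : ∀ x, koszulMap N (s x) + s (koszulMap N x) = x := by
    intro x
    induction x using TensorProduct.induction_on with
    | zero => simp
    | add x y hx hy =>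
      rw [map_add, map_add, map_add, map_add, add_add_add_comm, hx, hy]
    | tmul h ξ =>
      rw [hs, koszulMap_tmul, map_sum, map_sum]
      simp only [koszulMap_tmul, hs, hc]
      rw [Finset.sum_comm, ← Finset.sum_add_distrib]
      have h1 : ∀ i : Fin k, (∑ j, (N i (G j h)) ⊗ₜ[ℂ]
          (ExteriorAlgebra.ι ℂ (Pi.single i (1 : ℂ) : Fin k → ℂ) * c j ξ)) +
          ∑ j, (G j (N i h)) ⊗ₜ[ℂ] ((if i = j then (1 : ℂ) else 0) • ξ -
            ExteriorAlgebra.ι ℂ (Pi.single i (1 : ℂ) : Fin k → ℂ) * c j ξ) =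
          ((N i * G i) h) ⊗ₜ[ℂ] ξ := by
        intro i
        rw [← Finset.sum_add_distrib, Finset.sum_eq_single i]
        · have : G i (N i h) = N i (G i h) := (DFunLike.congr_fun (hNG i i).eq h).symm
          rw [this, ← TensorProduct.tmul_add, if_pos rfl, one_smul, add_sub_cancel]
          rfl
        · intro j _ hj
          have : G j (N i h) = N i (G j h) := (DFunLike.congr_fun (hNG i j).eq h).symm
          rw [this, ← TensorProduct.tmul_add, if_neg (Ne.symm hj), zero_smul, add_sub_cancel,
            TensorProduct.tmul_zero]
        · simp
      rw [Finset.sum_congr rfl fun i _ => h1 i, ← TensorProduct.sum_tmul, ← sum_apply, hsum]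
      rfl
  apply le_antisymm
  · rintro _ ⟨x, rfl⟩
    exact koszulMap_koszulMap hN x
  · intro x hx
    refine ⟨s x, ?_⟩
    have := hhom x
    rwa [LinearMap.mem_ker.1 hx, map_zero, add_zero] at this

theorem exists_sum_mul_X_sub_C (lam : Fin k → ℂ) (f : MvPolynomial (Fin k) ℂ) :
    ∃ g : Fin k → MvPolynomial (Fin k) ℂ, f - MvPolynomial.C (MvPolynomial.eval lam f) =
      ∑ i, (MvPolynomial.X i - MvPolynomial.C (lam i)) * g i := by
  induction f using MvPolynomial.induction_on with
  | C a => exact ⟨0, by simp⟩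
  | add p q hp hq =>
    obtain ⟨g, hg⟩ := hp
    obtain ⟨g', hg'⟩ := hq
    refine ⟨g + g', ?_⟩
    simp only [Pi.add_apply, mul_add, Finset.sum_add_distrib, ← hg, ← hg', map_add]
    ring
  | mul_X p j hp =>
    obtain ⟨g, hg⟩ := hp
    refine ⟨fun i => g i * MvPolynomial.X j +
      if i = j then MvPolynomial.C (MvPolynomial.eval lam p) else 0, ?_⟩
    simp only [mul_add, Finset.sum_add_distrib, ← mul_assoc, ← Finset.sum_mul, ← hg, mul_ite,
      mul_zero, Finset.sum_ite_eq', Finset.mem_univ, if_true, map_mul, MvPolynomial.eval_X]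
    ring

/-- A commuting tuple having `Γ_k` as a spectral set has its Taylor spectrum in `Γ_k`: a point
`lam` outside is separated by a polynomial `f`, and `f(T) - f(lam)` is invertible. -/
theorem taylorSpectrum_subset [CompleteSpace H] {T : Fin k → (H →L[ℂ] H)}
    (hT : ∀ i j, Commute (T i) (T j))
    (hf : ∀ f : MvPolynomial (Fin k) ℂ,
      ‖polyEval T f‖ ≤ sSup ((fun s => ‖MvPolynomial.eval s f‖) '' closedSymDisc k)) :
    taylorSpectrum T ⊆ closedSymDisc k := by
  intro lam hlam
  refine mem_closedSymDisc_of_hull fun f => ?_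
  by_contra hlt
  push Not at hlt
  refine hlam ?_
  obtain ⟨Φ, hΦ, hX⟩ := exists_algHom_of_commute hT
  obtain ⟨g, hg⟩ := exists_sum_mul_X_sub_C lam f
  have hnorm : ‖Φ f‖ * ‖(1 : H →L[ℂ] H)‖ < ‖MvPolynomial.eval lam f‖ := by
    refine lt_of_le_of_lt ?_ ((hf f).trans_lt hlt)
    rw [hΦ]
    exact mul_le_of_le_one_right (norm_nonneg _) ContinuousLinearMap.norm_id_le
  have hu : IsUnit (Φ (f - MvPolynomial.C (MvPolynomial.eval lam f))) := by
    have h1 := spectrum.mem_resolventSet_of_norm_lt_mul hnorm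
    have h2 : IsUnit (algebraMap ℂ (H →L[ℂ] H) (MvPolynomial.eval lam f) - Φ f) := h1
    rw [← IsUnit.neg_iff, neg_sub] at h2
    rwa [map_sub, ← MvPolynomial.algebraMap_eq, AlgHom.commutes]
  obtain ⟨u, hu⟩ := hu
  have hN : ∀ i, T i - lam i • (1 : H →L[ℂ] H) =
      Φ (MvPolynomial.X i - MvPolynomial.C (lam i)) := by
    intro i
    rw [map_sub, hX, ← MvPolynomial.algebraMap_eq, AlgHom.commutes, Algebra.algebraMap_eq_smul_one]
  have hΦc : ∀ p q, Commute (Φ p) (Φ q) := fun p q => (Commute.all p q).map Φ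
  simp only [hN]
  refine range_koszulMap_eq_ker (G := fun i => Φ (g i) * ↑u⁻¹) (fun i j => hΦc _ _)
    (fun i j => (hΦc _ _).mul_right ?_) ?_
  · have : Commute (Φ (MvPolynomial.X i - MvPolynomial.C (lam i))) (u : H →L[ℂ] H) := by
      rw [hu]; exact hΦc _ _
    exact this.units_inv_right
  · simp only [← mul_assoc, ← Finset.sum_mul, ← map_mul, ← map_sum]
    rw [← hg, ← hu, Units.mul_inv]

end Taylor

/-! ### Commuting normal operators over a point of the circle -/

section Normal

universe u

open scoped ComplexConjugate

/-- Commuting normal elements of a C*-algebra lie in a commutative C*-subalgebra. The hypothesis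
`hN'` would follow from `hN` by Fuglede's theorem; it is immediate for the pencils below. -/
theorem exists_commCStarAlgebra {A : Type u} [CStarAlgebra A] {ι : Type*} {N : ι → A}
    (hN : ∀ i j, Commute (N i) (N j)) (hN' : ∀ i j, Commute (N i) (star (N j))) :
    ∃ (C : Type u) (_ : CommCStarAlgebra C) (φ : C →⋆ₐ[ℂ] A) (t : ι → C),
      (∀ c, ‖φ c‖ = ‖c‖) ∧ ∀ i, φ (t i) = N i := by
  have hc := StarAlgebra.isMulCommutative_adjoin ℂ (s := Set.range N)
    (by rintro _ ⟨i, rfl⟩ _ ⟨j, rfl⟩; exact hN i j)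
    (by rintro _ ⟨i, rfl⟩ _ ⟨j, rfl⟩; exact hN' i j)
  let U := (StarAlgebra.adjoin ℂ (Set.range N)).topologicalClosure
  have hclosed : IsClosed (U : Set A) := StarSubalgebra.isClosed_topologicalClosure _
  have hcomm : ∀ x y : U, x * y = y * x :=
    ((StarAlgebra.adjoin ℂ (Set.range N)).commRingTopologicalClosure mul_comm').mul_comm
  let _ : CommCStarAlgebra U :=
    { StarSubalgebra.cstarAlgebra U with mul_comm := hcomm }
  exact ⟨U, inferInstance, U.subtype, fun i => ⟨N i, StarSubalgebra.le_topologicalClosure _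
    (StarAlgebra.subset_adjoin ℂ _ ⟨i, rfl⟩)⟩, fun _ => rfl, fun _ => rfl⟩

theorem exists_character_norm_eq {C : Type*} [CommCStarAlgebra C] [Nontrivial C] (c : C) :
    ∃ χ : WeakDual.characterSpace ℂ C, ‖χ c‖ = ‖c‖ := by
  obtain ⟨w, hw, hr⟩ := spectrum.exists_nnnorm_eq_spectralRadius c
  obtain ⟨χ, rfl⟩ := WeakDual.CharacterSpace.mem_spectrum_iff_exists.1 hw
  refine ⟨χ, ?_⟩
  rw [IsStarNormal.spectralRadius_eq_nnnorm] at hr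
  exact congrArg NNReal.toReal (ENNReal.coe_injective hr)

variable {E : Type*} [NormedAddCommGroup E] [InnerProductSpace ℂ E] [CompleteSpace E]

/-- If `N` is a commuting tuple with `N_i* = conj ω N_{n-i}`, `|ω| = 1`, and its weighted tuple has
`Γ_m` as a spectral set, then `(N, ω)` has `Γ_{m+1}` as a spectral set. All characters of the
C*-algebra generated by `N` send the weighted tuple into `Γ_m` by polynomial convexity, hence
send `(N, ω)` into `Γ_{m+1}`. -/
theorem norm_polyEval_snoc_le {m : ℕ} {N : Fin m → (E →L[ℂ] E)} {ω : ℂ} (hω : ‖ω‖ = 1)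
    (hcomm : ∀ i j, Commute (N i) (N j)) (hadj : ∀ i, adjoint (N i) = conj ω • N i.rev)
    (hsp : ∀ f : MvPolynomial (Fin m) ℂ,
      ‖polyEval (fun i : Fin m => (((m : ℂ) - (i.val : ℂ)) / ((m : ℂ) + 1)) • N i) f‖ ≤
        sSup ((fun s => ‖MvPolynomial.eval s f‖) '' closedSymDisc m))
    (f : MvPolynomial (Fin (m + 1)) ℂ) :
    ‖polyEval (Fin.snoc N (ω • 1) : Fin (m + 1) → (E →L[ℂ] E)) f‖ ≤
      sSup ((fun s => ‖MvPolynomial.eval s f‖) '' closedSymDisc (m + 1)) := by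
  have hω' : ω * conj ω = 1 := by rw [Complex.mul_conj, Complex.normSq_eq_norm_sq, hω]; simp
  obtain ⟨C, _, φ, t, hφ, ht⟩ := exists_commCStarAlgebra hcomm fun i j => by
    rw [ContinuousLinearMap.star_eq_adjoint, hadj]
    exact (hcomm i j.rev).smul_right _
  have hφinj : Function.Injective φ := by
    intro x y hxy
    rw [← sub_eq_zero, ← norm_eq_zero, ← hφ, map_sub, hxy, sub_self, norm_zero]
  have hstar : ∀ i, star (t i) = conj ω • t i.rev := by
    intro i
    apply hφinj
    rw [map_star, ht, map_smul, ht, ContinuousLinearMap.star_eq_adjoint, hadj]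
  let t' : Fin (m + 1) → C := Fin.snoc t (ω • 1)
  have ht' : ∀ i, φ (t' i) = (Fin.snoc N (ω • 1) : Fin (m + 1) → (E →L[ℂ] E)) i := by
    intro i
    induction i using Fin.lastCases with
    | last => simp [t']
    | cast i => simp [t', ht]
  have hval : polyEval (Fin.snoc N (ω • 1) : Fin (m + 1) → (E →L[ℂ] E)) f =
      φ (MvPolynomial.aeval t' f) := by
    rw [← funext ht']
    exact polyEval_eq_aeval φ.toAlgHom t' f
  rw [hval, hφ]
  rcases subsingleton_or_nontrivial C with hC | hC
  · rw [Subsingleton.elim (MvPolynomial.aeval t' f) 0, norm_zero]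
    exact Real.sSup_nonneg (by rintro _ ⟨_, _, rfl⟩; exact norm_nonneg _)
  obtain ⟨χ, hχ⟩ := exists_character_norm_eq (MvPolynomial.aeval t' f)
  have heval : ∀ {k : ℕ} (u : Fin k → C) (g : MvPolynomial (Fin k) ℂ),
      χ (MvPolynomial.aeval u g) = MvPolynomial.eval (fun i => χ (u i)) g := by
    intro k u g
    rw [← MvPolynomial.aeval_eq_eval]
    exact MvPolynomial.comp_aeval_apply u (WeakDual.CharacterSpace.toAlgHom χ) g
  rw [← hχ, heval]
  refine norm_eval_le_sSup f ?_
  have hsnoc : (fun i => χ (t' i)) = (Fin.snoc (fun i => χ (t i)) ω : Fin (m + 1) → ℂ) := by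
    funext i
    induction i using Fin.lastCases with
    | last => simp [t']
    | cast i => simp [t']
  rw [hsnoc]
  refine snoc_mem_closedSymDisc hω (fun i => ?_) (mem_closedSymDisc_of_hull fun g => ?_)
  · have h1 := congrArg χ (hstar i)
    rw [map_star, map_smul, smul_eq_mul] at h1
    have h2 := congrArg χ (hstar i.rev)
    rw [map_star, map_smul, smul_eq_mul, Fin.rev_rev] at h2
    rw [starRingEnd_apply, h2, mul_right_comm, mul_comm (conj ω), hω', one_mul]
  · refine le_trans ?_ (hsp g)
    have h1 : polyEval (fun i : Fin m => (((m : ℂ) - (i.val : ℂ)) / ((m : ℂ) + 1)) • N i) g =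
        φ (MvPolynomial.aeval
          (fun i : Fin m => (((m : ℂ) - (i.val : ℂ)) / ((m : ℂ) + 1)) • t i) g) := by
      rw [show (fun i : Fin m => (((m : ℂ) - (i.val : ℂ)) / ((m : ℂ) + 1)) • N i) =
        fun i => φ.toAlgHom ((((m : ℂ) - (i.val : ℂ)) / ((m : ℂ) + 1)) • t i) from
          funext fun i => by
            rw [map_smul]
            exact congrArg _ (ht i).symm]
      exact polyEval_eq_aeval φ.toAlgHom _ g
    rw [h1, hφ]
    refine le_trans (le_of_eq ?_) (spectrum.norm_le_norm_of_mem (AlgHom.apply_mem_spectrum χ _))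
    rw [heval]
    simp only [map_smul, smul_eq_mul]

end Normal

/-! ### Toeplitz operators with operator coefficients on `ℓ²(ℕ, E)` -/

section Hardy

open scoped ComplexConjugate

/-- `ℓ²(ℕ, E)`, the coefficient model of the vector-valued Hardy space. -/
def SeqSpace (E : Type*) [NormedAddCommGroup E] : Type _ := lp (fun _ : ℕ => E) 2

namespace SeqSpace

variable {E : Type*} [NormedAddCommGroup E]

noncomputable instance : NormedAddCommGroup (SeqSpace E) :=
  inferInstanceAs (NormedAddCommGroup (lp (fun _ : ℕ => E) 2))

variable [InnerProductSpace ℂ E]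

noncomputable instance : InnerProductSpace ℂ (SeqSpace E) :=
  inferInstanceAs (InnerProductSpace ℂ (lp (fun _ : ℕ => E) 2))

instance [CompleteSpace E] : CompleteSpace (SeqSpace E) :=
  inferInstanceAs (CompleteSpace (lp (fun _ : ℕ => E) 2))

/-- The underlying element of Mathlib's `ℓ²` space. -/
def toLp (x : SeqSpace E) : lp (fun _ : ℕ => E) 2 := x

/-- The `n`-th coefficient. -/
def coord (n : ℕ) : SeqSpace E →ₗ[ℂ] E where
  toFun x := (toLp x : ∀ _ : ℕ, E) n
  map_add' _ _ := rfl
  map_smul' _ _ := rfl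

@[ext]
theorem ext {x y : SeqSpace E} (h : ∀ n, coord n x = coord n y) : x = y :=
  lp.ext (f := toLp x) (g := toLp y) (funext h)

theorem hasSum_inner (x y : SeqSpace E) :
    HasSum (fun n => inner ℂ (coord n x) (coord n y)) (inner ℂ x y) :=
  lp.hasSum_inner (𝕜 := ℂ) (toLp x) (toLp y)

theorem hasSum_norm_sq (x : SeqSpace E) : HasSum (fun n => ‖coord n x‖ ^ 2) (‖x‖ ^ 2) := by
  rw [← Complex.hasSum_ofReal]
  have := hasSum_inner x x
  simpa only [inner_self_eq_norm_sq_to_K, Complex.coe_algebraMap, Complex.ofReal_pow] using this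

/-- The element with prescribed square-summable coefficients. -/
def mk (f : ℕ → E) (hf : Summable fun n => ‖f n‖ ^ 2) : SeqSpace E :=
  (⟨f, memℓp_gen (by simpa using hf)⟩ : lp (fun _ : ℕ => E) 2)

theorem coord_mk (f : ℕ → E) (hf : Summable fun n => ‖f n‖ ^ 2) (n : ℕ) :
    coord n (mk f hf) = f n := rfl

variable {X : Type*} [NormedAddCommGroup X] [InnerProductSpace ℂ X]

/-- The operator into `ℓ²(ℕ, E)` with prescribed square-summable coefficients. -/
noncomputable def opOfCoeff (φ : ℕ → X →ₗ[ℂ] E) (C : ℝ) (hC : 0 ≤ C)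
    (h : ∀ x N, ∑ n ∈ Finset.range N, ‖φ n x‖ ^ 2 ≤ (C * ‖x‖) ^ 2) : X →L[ℂ] SeqSpace E :=
  LinearMap.mkContinuous
    { toFun x := mk (fun n => φ n x)
        (summable_of_sum_range_le (fun _ => by positivity) (h x))
      map_add' x y := by ext n; simp [coord_mk]
      map_smul' c x := by ext n; simp [coord_mk] }
    C fun x => by
      rw [← sq_le_sq₀ (norm_nonneg _) (by positivity), ← (hasSum_norm_sq _).tsum_eq]
      exact Real.tsum_le_of_sum_range_le (fun _ => by positivity) (h x)

theorem coord_opOfCoeff {φ : ℕ → X →ₗ[ℂ] E} {C : ℝ} {hC : 0 ≤ C}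
    {h : ∀ x N, ∑ n ∈ Finset.range N, ‖φ n x‖ ^ 2 ≤ (C * ‖x‖) ^ 2} (x : X) (n : ℕ) :
    coord n (opOfCoeff φ C hC h x) = φ n x := rfl

theorem norm_opOfCoeff_le {φ : ℕ → X →ₗ[ℂ] E} {C : ℝ} {hC : 0 ≤ C}
    {h : ∀ x N, ∑ n ∈ Finset.range N, ‖φ n x‖ ^ 2 ≤ (C * ‖x‖) ^ 2} :
    ‖opOfCoeff φ C hC h‖ ≤ C :=
  LinearMap.mkContinuous_norm_le _ hC _

theorem sum_range_norm_sq_le (x : SeqSpace E) (N : ℕ) :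
    ∑ n ∈ Finset.range N, ‖coord n x‖ ^ 2 ≤ ‖x‖ ^ 2 :=
  sum_le_hasSum _ (fun _ _ => by positivity) (hasSum_norm_sq x)

/-- The inclusion of `E` as the space of the `k`-th coefficient. -/
noncomputable def single (k : ℕ) : E →L[ℂ] SeqSpace E :=
  opOfCoeff (fun n => if n = k then LinearMap.id else 0) 1 zero_le_one fun e N => by
    rw [one_mul]
    refine (Finset.sum_le_sum (g := fun n => if n = k then ‖e‖ ^ 2 else 0) fun n _ => ?_).trans ?_
    · split_ifs <;> simp
    · rw [Finset.sum_ite_eq']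
      split_ifs
      exacts [le_rfl, by positivity]

theorem coord_single (n k : ℕ) (e : E) : coord n (single k e) = if n = k then e else 0 := by
  rw [single, coord_opOfCoeff]
  split_ifs <;> rfl

theorem inner_single_left (n : ℕ) (e : E) (x : SeqSpace E) :
    inner ℂ (single n e) x = inner ℂ e (coord n x) := by
  refine (hasSum_inner (single n e) x).unique ?_
  have := hasSum_ite_eq n (inner ℂ e (coord n x))
  refine this.congr_fun fun j => ?_
  rw [coord_single]
  split_ifs with h
  · rw [h]
  · rw [inner_zero_left]

/-- The coefficientwise action of an operator on `E`. -/
noncomputable def ampl (B : E →L[ℂ] E) : SeqSpace E →L[ℂ] SeqSpace E :=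
  opOfCoeff (fun n => (B : E →ₗ[ℂ] E) ∘ₗ coord n) ‖B‖ (norm_nonneg B) fun x N => by
    rw [mul_pow]
    refine le_trans ?_ (mul_le_mul_of_nonneg_left (sum_range_norm_sq_le x N) (by positivity))
    rw [Finset.mul_sum]
    refine Finset.sum_le_sum fun n _ => ?_
    rw [← mul_pow]
    exact pow_le_pow_left₀ (norm_nonneg _) (B.le_opNorm _) 2

theorem coord_ampl (B : E →L[ℂ] E) (x : SeqSpace E) (n : ℕ) :
    coord n (ampl B x) = B (coord n x) := rfl

/-- The unilateral shift, that is, multiplication by the coordinate function. -/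
noncomputable def shift : SeqSpace E →L[ℂ] SeqSpace E :=
  opOfCoeff (fun n => Nat.casesOn n 0 coord) 1 zero_le_one fun x N => by
    rw [one_mul]
    refine le_trans ?_ (sum_range_norm_sq_le x N)
    cases N with
    | zero => simp
    | succ N =>
      rw [Finset.sum_range_succ', Finset.sum_range_succ]
      simp

theorem coord_zero_shift (x : SeqSpace E) : coord 0 (shift x) = 0 := rfl

theorem coord_succ_shift (x : SeqSpace E) (n : ℕ) : coord (n + 1) (shift x) = coord n x := rfl

/-- The inclusion of `E` as the constant functions. -/
noncomputable def const : E →L[ℂ] SeqSpace E := single 0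

theorem coord_zero_const (e : E) : coord 0 (const e) = e := by
  rw [const, coord_single, if_pos rfl]

theorem coord_succ_const (n : ℕ) (e : E) : coord (n + 1) (const e) = 0 := by
  rw [const, coord_single, if_neg (Nat.succ_ne_zero n)]

theorem inner_const_left (e : E) (x : SeqSpace E) :
    inner ℂ (const e) x = inner ℂ e (coord 0 x) :=
  inner_single_left 0 e x

theorem shift_single (n : ℕ) (e : E) : shift (single n e) = single (n + 1) e := by
  ext j
  cases j with
  | zero => rw [coord_zero_shift, coord_single, if_neg (Nat.succ_ne_zero n).symm]
  | succ j => simp [coord_succ_shift, coord_single]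

theorem shift_pow_const (n : ℕ) (e : E) : (shift ^ n) (const e) = single n e := by
  induction n with
  | zero => rfl
  | succ n ih => rw [pow_succ', mul_apply_eq_comp, ih, shift_single]

theorem ampl_single (B : E →L[ℂ] E) (n : ℕ) (e : E) : ampl B (single n e) = single n (B e) := by
  ext j
  rw [coord_ampl, coord_single, coord_single]
  split_ifs <;> simp

theorem ampl_const (B : E →L[ℂ] E) (e : E) : ampl B (const e) = const (B e) :=
  ampl_single B 0 e

theorem ampl_shift (B : E →L[ℂ] E) (x : SeqSpace E) : ampl B (shift x) = shift (ampl B x) := by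
  ext n
  cases n with
  | zero => rw [coord_ampl, coord_zero_shift, coord_zero_shift, map_zero]
  | succ n => rw [coord_ampl, coord_succ_shift, coord_succ_shift, coord_ampl]

variable [CompleteSpace E]

theorem coord_adjoint_shift (x : SeqSpace E) (n : ℕ) :
    coord n ((shift†) x) = coord (n + 1) x := by
  refine ext_inner_left ℂ fun e => ?_
  rw [← inner_single_left, adjoint_inner_right, shift_single, inner_single_left]

theorem adjoint_const_apply (x : SeqSpace E) : (const†) x = coord 0 x := by
  refine ext_inner_left ℂ fun e => ?_
  rw [adjoint_inner_right, const, inner_single_left]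

theorem adjoint_shift_shift (x : SeqSpace E) : (shift†) (shift x) = x := by
  ext n
  rw [coord_adjoint_shift, coord_succ_shift]

theorem norm_adjoint_shift_le : ‖(shift† : SeqSpace E →L[ℂ] SeqSpace E)‖ ≤ 1 := by
  rw [LinearIsometryEquiv.norm_map]
  exact norm_opOfCoeff_le

theorem adjoint_shift_const (e : E) : (shift†) (const e) = 0 := by
  ext n
  rw [coord_adjoint_shift, const, coord_single, if_neg (Nat.succ_ne_zero n), map_zero]

theorem const_add_shift (x : SeqSpace E) : const (coord 0 x) + shift ((shift†) x) = x := by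
  ext n
  rw [map_add]
  cases n with
  | zero => rw [coord_zero_shift, coord_zero_const, add_zero]
  | succ n =>
    rw [coord_succ_shift, coord_adjoint_shift, const, coord_single,
      if_neg (Nat.succ_ne_zero n), zero_add]

theorem ampl_adjoint_shift (B : E →L[ℂ] E) (x : SeqSpace E) :
    ampl B ((shift†) x) = (shift†) (ampl B x) := by
  ext n
  rw [coord_ampl, coord_adjoint_shift, coord_adjoint_shift, coord_ampl]

theorem adjoint_ampl (B : E →L[ℂ] E) : (ampl B)† = ampl (B†) := by
  refine ContinuousLinearMap.ext fun x => ext fun n => ext_inner_left ℂ fun e => ?_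
  rw [← inner_single_left, adjoint_inner_right, ampl_single, inner_single_left, coord_ampl,
    adjoint_inner_right]

/-- An operator is determined by its values on the monomials `zⁿ e`. -/
theorem eq_of_shift_pow_const {X : Type*} [NormedAddCommGroup X] [InnerProductSpace ℂ X]
    [CompleteSpace X] {S T : SeqSpace E →L[ℂ] X}
    (h : ∀ n e, S ((shift ^ n) (const e)) = T ((shift ^ n) (const e))) : S = T := by
  refine adjoint.injective (ContinuousLinearMap.ext fun y => ext fun n =>
    ext_inner_left ℂ fun e => ?_)
  rw [← inner_single_left, ← inner_single_left, adjoint_inner_right, adjoint_inner_right,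
    ← shift_pow_const, h]

/-! ### Point evaluation in the disc -/

/-- The resolvent `(1 - z L)⁻¹` of the backward shift `L`. -/
noncomputable def resolventShift (z : ℂ) : SeqSpace E →L[ℂ] SeqSpace E :=
  Ring.inverse (1 - z • shift†)

/-- The value at `z` of the function with coefficients `x`, written as the constant coefficient
of `(1 - z L)⁻¹ x` with `L` the backward shift. -/
noncomputable def evalAt (z : ℂ) (x : SeqSpace E) : E :=
  coord 0 (resolventShift z x)

theorem isUnit_one_sub_smul_shift {z : ℂ} (hz : ‖z‖ < 1) :
    IsUnit (1 - z • shift† : SeqSpace E →L[ℂ] SeqSpace E) := by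
  refine isUnit_one_sub_of_norm_lt_one ?_
  rw [norm_smul]
  have := norm_adjoint_shift_le (E := E)
  nlinarith [norm_nonneg z, norm_nonneg (shift† : SeqSpace E →L[ℂ] SeqSpace E)]

theorem inverse_one_sub_apply {z : ℂ} (hz : ‖z‖ < 1) (x : SeqSpace E) :
    resolventShift z (x - z • (shift†) x) = x := by
  have := DFunLike.congr_fun (Ring.inverse_mul_cancel _ (isUnit_one_sub_smul_shift (E := E) hz)) x
  exact this

theorem one_sub_inverse_apply {z : ℂ} (hz : ‖z‖ < 1) (x : SeqSpace E) :
    resolventShift z x - z • (shift†) (resolventShift z x) = x := by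
  have := DFunLike.congr_fun (Ring.mul_inverse_cancel _ (isUnit_one_sub_smul_shift (E := E) hz)) x
  exact this

theorem evalAt_add (z : ℂ) (x y : SeqSpace E) : evalAt z (x + y) = evalAt z x + evalAt z y := by
  rw [evalAt, map_add, map_add]; rfl

theorem evalAt_neg (z : ℂ) (x : SeqSpace E) : evalAt z (-x) = -evalAt z x := by
  rw [evalAt, map_neg, map_neg]; rfl

theorem evalAt_zero (z : ℂ) : evalAt z (0 : SeqSpace E) = 0 := by
  rw [evalAt, map_zero, map_zero]

theorem evalAt_eq {z : ℂ} (hz : ‖z‖ < 1) (x : SeqSpace E) :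
    evalAt z x = coord 0 x + z • evalAt z ((shift†) x) := by
  have h := inverse_one_sub_apply hz x
  rw [map_sub, map_smul, sub_eq_iff_eq_add] at h
  rw [evalAt, h, map_add, map_smul]
  rfl

theorem evalAt_shift {z : ℂ} (hz : ‖z‖ < 1) (x : SeqSpace E) :
    evalAt z (shift x) = z • evalAt z x := by
  rw [evalAt_eq hz, coord_zero_shift, zero_add, adjoint_shift_shift]

theorem evalAt_const {z : ℂ} (hz : ‖z‖ < 1) (e : E) : evalAt z (const e) = e := by
  rw [evalAt_eq hz, coord_zero_const, adjoint_shift_const, evalAt_zero, smul_zero, add_zero]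

theorem evalAt_ampl {z : ℂ} (hz : ‖z‖ < 1) (B : E →L[ℂ] E) (x : SeqSpace E) :
    evalAt z (ampl B x) = B (evalAt z x) := by
  rw [evalAt, evalAt, ← coord_ampl]
  refine congrArg (coord 0) ?_
  conv_lhs => rw [← one_sub_inverse_apply hz x]
  rw [map_sub, map_smul, ampl_adjoint_shift, inverse_one_sub_apply hz]

/-- A function in the Hardy space vanishing on the disc has vanishing coefficients. -/
theorem eq_zero_of_evalAt {x : SeqSpace E} (h : ∀ z : ℂ, ‖z‖ < 1 → evalAt z x = 0) : x = 0 := by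
  have hstep : ∀ x : SeqSpace E, (∀ z : ℂ, ‖z‖ < 1 → evalAt z x = 0) →
      coord 0 x = 0 ∧ ∀ z : ℂ, ‖z‖ < 1 → evalAt z ((shift†) x) = 0 := by
    intro x hx
    have h0 : coord 0 x = 0 := by
      have := evalAt_eq (z := 0) (by simp) x
      rw [hx 0 (by simp), zero_smul, add_zero] at this
      exact this.symm
    have hne : ∀ z : ℂ, ‖z‖ < 1 → z ≠ 0 → evalAt z ((shift†) x) = 0 := by
      intro z hz hz0
      have := evalAt_eq hz x
      rw [hx z hz, h0, zero_add] at this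
      exact (smul_eq_zero.1 this.symm).resolve_left hz0
    refine ⟨h0, fun z hz => ?_⟩
    by_cases hz0 : z = 0
    · subst hz0
      -- the value at the origin is obtained by continuity
      have hc : ContinuousAt (fun z : ℂ => evalAt z ((shift†) x)) 0 := by
        have hinv : ContinuousAt (fun z : ℂ =>
            Ring.inverse (1 - z • shift† : SeqSpace E →L[ℂ] SeqSpace E)) 0 := by
          obtain ⟨u, hu⟩ := isUnit_one_sub_smul_shift (E := E) (z := 0) (by simp)
          refine ContinuousAt.comp (f := fun z : ℂ =>
            (1 - z • shift† : SeqSpace E →L[ℂ] SeqSpace E)) (g := Ring.inverse) ?_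
            (by fun_prop)
          rw [← hu]
          exact NormedRing.inverse_continuousAt u
        have h1 := (const† : SeqSpace E →L[ℂ] E).continuous.continuousAt.comp
          (hinv.clm_apply continuousAt_const (g := fun _ => (shift†) x))
        refine h1.congr (Filter.Eventually.of_forall fun z => ?_)
        exact adjoint_const_apply _
      refine tendsto_nhds_unique (hc.tendsto.mono_left (nhdsWithin_le_nhds (s := {0}ᶜ))) ?_
      refine tendsto_const_nhds.congr' ?_
      have : ∀ᶠ z : ℂ in nhds 0, ‖z‖ < 1 := by
        filter_upwards [Metric.ball_mem_nhds (0 : ℂ) one_pos] with z hz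
        simpa using hz
      filter_upwards [nhdsWithin_le_nhds this, self_mem_nhdsWithin] with z h1 h2
      exact (hne z h1 h2).symm
    · exact hne z hz hz0
  refine ext fun n => ?_
  induction n generalizing x with
  | zero => exact (hstep x h).1
  | succ n ih =>
    rw [← coord_adjoint_shift]
    exact ih (hstep x h).2

theorem eq_of_evalAt {x y : SeqSpace E} (h : ∀ z : ℂ, ‖z‖ < 1 → evalAt z x = evalAt z y) :
    x = y := by
  rw [← sub_eq_zero]
  refine eq_zero_of_evalAt fun z hz => ?_
  rw [sub_eq_add_neg, evalAt_add, evalAt_neg, h z hz, add_neg_cancel]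

/-! ### The norm of a polynomial in Toeplitz operators with linear symbols -/

/-- The finitely supported sequences inside `ℓ²(ℕ, E)`. -/
noncomputable def ofFinsupp : (ℕ →₀ E) →ₗ[ℂ] SeqSpace E :=
  Finsupp.lsum ℂ fun n => ((single n : E →L[ℂ] SeqSpace E) : E →ₗ[ℂ] SeqSpace E)

omit [CompleteSpace E] in
theorem ofFinsupp_single (n : ℕ) (e : E) : ofFinsupp (Finsupp.single n e) = single n e := by
  simp [ofFinsupp]

omit [CompleteSpace E] in
theorem coord_ofFinsupp (v : ℕ →₀ E) (n : ℕ) : coord n (ofFinsupp v) = v n := by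
  induction v using Finsupp.induction_linear with
  | zero => simp
  | add v w hv hw => rw [map_add, map_add, hv, hw, Finsupp.add_apply]
  | single k e => rw [ofFinsupp_single, coord_single, Finsupp.single_apply]; simp only [eq_comm]

theorem denseRange_ofFinsupp : DenseRange (ofFinsupp (E := E)) := by
  have : (LinearMap.range (ofFinsupp (E := E))).topologicalClosure = ⊤ := by
    rw [Submodule.topologicalClosure_eq_top_iff, Submodule.eq_bot_iff]
    intro x hx
    refine ext fun n => ext_inner_left ℂ fun e => ?_
    rw [← inner_single_left, ← ofFinsupp_single, map_zero, inner_zero_right]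
    exact (Submodule.mem_orthogonal _ _).1 hx _ ⟨_, rfl⟩
  rw [denseRange_iff_closure_range]
  exact congrArg (fun U : Submodule ℂ (SeqSpace E) => (U : Set (SeqSpace E))) this

omit [CompleteSpace E] in
theorem norm_ofFinsupp_sq {v : ℕ →₀ E} {N : ℕ} (hv : v.support ⊆ Finset.range N) :
    ‖ofFinsupp v‖ ^ 2 = ∑ n ∈ Finset.range N, ‖v n‖ ^ 2 := by
  rw [← (hasSum_norm_sq (ofFinsupp v)).tsum_eq]
  simp only [coord_ofFinsupp]
  refine tsum_eq_sum fun n hn => ?_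
  rw [Finsupp.notMem_support_iff.1 fun h => hn (hv h)]
  simp

/-- The value at `ω` of the polynomial with coefficients `v`. -/
noncomputable def polyVal (ω : ℂ) : (ℕ →₀ E) →ₗ[ℂ] E :=
  Finsupp.lsum ℂ fun n => ω ^ n • (LinearMap.id : E →ₗ[ℂ] E)

omit [CompleteSpace E] in
theorem polyVal_single (ω : ℂ) (n : ℕ) (e : E) : polyVal ω (Finsupp.single n e) = ω ^ n • e := by
  simp [polyVal]

omit [CompleteSpace E] in
theorem polyVal_eq_sum (ω : ℂ) {v : ℕ →₀ E} {N : ℕ} (hv : v.support ⊆ Finset.range N) :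
    polyVal ω v = ∑ n ∈ Finset.range N, ω ^ n • v n := by
  rw [polyVal, Finsupp.lsum_apply, Finsupp.sum_of_support_subset _ hv]
  · rfl
  · simp

omit [CompleteSpace E] in
/-- Parseval's identity over the `N`-th roots of unity. -/
theorem sum_norm_polyVal_sq {N : ℕ} (hN : N ≠ 0) {ζ : ℂ} (hζ : IsPrimitiveRoot ζ N) {v : ℕ →₀ E}
    (hv : v.support ⊆ Finset.range N) :
    ∑ j ∈ Finset.range N, ‖polyVal (ζ ^ j) v‖ ^ 2 = N * ‖ofFinsupp v‖ ^ 2 := by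
  have hζ0 : ζ ≠ 0 := hζ.ne_zero hN
  have hconj : conj ζ = ζ⁻¹ := by
    rw [Complex.inv_eq_conj (hζ.norm'_eq_one hN)]
  have horth : ∀ n ∈ Finset.range N, ∀ l ∈ Finset.range N,
      ∑ j ∈ Finset.range N, conj ((ζ ^ j) ^ n) * (ζ ^ j) ^ l = if n = l then (N : ℂ) else 0 := by
    intro n hn l hl
    have hterm : ∀ j, conj ((ζ ^ j) ^ n) * (ζ ^ j) ^ l = ((ζ ^ n)⁻¹ * ζ ^ l) ^ j := by
      intro j
      rw [map_pow, map_pow, hconj, mul_pow, inv_pow, inv_pow, inv_pow, ← pow_mul, ← pow_mul,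
        ← pow_mul, ← pow_mul, mul_comm j, mul_comm j]
    simp only [hterm]
    split_ifs with h
    · subst h
      rw [inv_mul_cancel₀ (pow_ne_zero _ hζ0)]
      simp
    · have hne : (ζ ^ n)⁻¹ * ζ ^ l ≠ 1 := by
        intro h1
        rw [inv_mul_eq_one₀ (pow_ne_zero _ hζ0)] at h1
        exact h (hζ.pow_inj (Finset.mem_range.1 hn) (Finset.mem_range.1 hl) h1)
      have hg := mul_neg_geom_sum ((ζ ^ n)⁻¹ * ζ ^ l) N
      rw [mul_pow, inv_pow, ← pow_mul, ← pow_mul, mul_comm n, mul_comm l, pow_mul, pow_mul,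
        hζ.pow_eq_one, one_pow, one_pow, inv_one, one_mul, sub_self] at hg
      exact (mul_eq_zero.1 hg).resolve_left (sub_ne_zero.2 hne.symm)
  rw [norm_ofFinsupp_sq hv]
  have hcast : ((∑ j ∈ Finset.range N, ‖polyVal (ζ ^ j) v‖ ^ 2 : ℝ) : ℂ) =
      ((N * ∑ n ∈ Finset.range N, ‖v n‖ ^ 2 : ℝ) : ℂ) := by
    push_cast
    calc ∑ j ∈ Finset.range N, (‖polyVal (ζ ^ j) v‖ : ℂ) ^ 2
        = ∑ j ∈ Finset.range N, ∑ n ∈ Finset.range N, ∑ l ∈ Finset.range N,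
            (conj ((ζ ^ j) ^ n) * (ζ ^ j) ^ l) * inner ℂ (v n) (v l) := by
          refine Finset.sum_congr rfl fun j _ => ?_
          have : inner ℂ (polyVal (ζ ^ j) v) (polyVal (ζ ^ j) v) =
              (‖polyVal (ζ ^ j) v‖ : ℂ) ^ 2 := inner_self_eq_norm_sq_to_K _
          rw [← this, polyVal_eq_sum _ hv, sum_inner]
          refine Finset.sum_congr rfl fun n _ => ?_
          rw [inner_sum]
          refine Finset.sum_congr rfl fun l _ => ?_
          rw [inner_smul_left, inner_smul_right, mul_assoc]
      _ = ∑ n ∈ Finset.range N, ∑ l ∈ Finset.range N,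
            (if n = l then (N : ℂ) else 0) * inner ℂ (v n) (v l) := by
          rw [Finset.sum_comm]
          refine Finset.sum_congr rfl fun n hn => ?_
          rw [Finset.sum_comm]
          refine Finset.sum_congr rfl fun l hl => ?_
          rw [← Finset.sum_mul, horth n hn l hl]
      _ = N * ∑ n ∈ Finset.range N, (‖v n‖ : ℂ) ^ 2 := by
          rw [Finset.mul_sum]
          refine Finset.sum_congr rfl fun n hn => ?_
          have : inner ℂ (v n) (v n) = (‖v n‖ : ℂ) ^ 2 := inner_self_eq_norm_sq_to_K _
          rw [Finset.sum_eq_single_of_mem n hn fun l _ hl => by rw [if_neg hl.symm, zero_mul],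
            if_pos rfl, this]
  exact_mod_cast hcast

/-- The analytic Toeplitz operator with symbol `C₀ + z C₁`. -/
noncomputable def toeplitz (C₀ C₁ : E →L[ℂ] E) : SeqSpace E →L[ℂ] SeqSpace E :=
  ampl C₀ + shift ∘L ampl C₁

omit [CompleteSpace E] in
theorem toeplitz_apply (C₀ C₁ : E →L[ℂ] E) (x : SeqSpace E) :
    toeplitz C₀ C₁ x = ampl C₀ x + shift (ampl C₁ x) := rfl

omit [CompleteSpace E] in
theorem toeplitz_shift (C₀ C₁ : E →L[ℂ] E) (x : SeqSpace E) :
    toeplitz C₀ C₁ (shift x) = shift (toeplitz C₀ C₁ x) := by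
  rw [toeplitz_apply, toeplitz_apply, ampl_shift, ampl_shift, map_add]

theorem evalAt_toeplitz {z : ℂ} (hz : ‖z‖ < 1) (C₀ C₁ : E →L[ℂ] E) (x : SeqSpace E) :
    evalAt z (toeplitz C₀ C₁ x) = (C₀ + z • C₁) (evalAt z x) := by
  rw [toeplitz_apply, evalAt_add, evalAt_shift hz, evalAt_ampl hz, evalAt_ampl hz]
  rfl

theorem toeplitz_comm {C₀ C₁ C₀' C₁' : E →L[ℂ] E}
    (h : ∀ z : ℂ, ‖z‖ < 1 → Commute (C₀ + z • C₁) (C₀' + z • C₁')) (x : SeqSpace E) :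
    toeplitz C₀ C₁ (toeplitz C₀' C₁' x) = toeplitz C₀' C₁' (toeplitz C₀ C₁ x) := by
  refine eq_of_evalAt fun z hz => ?_
  rw [evalAt_toeplitz hz, evalAt_toeplitz hz, evalAt_toeplitz hz, evalAt_toeplitz hz]
  exact DFunLike.congr_fun (h z hz).eq _

/-- A polynomial in Toeplitz operators with linear symbols is bounded by the supremum over the
circle of the same polynomial in the symbols. -/
theorem norm_polyEval_toeplitz_le {k : ℕ} (C₀ C₁ : Fin k → (E →L[ℂ] E))
    (f : MvPolynomial (Fin k) ℂ) {c : ℝ} (hc : 0 ≤ c)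
    (h : ∀ ω : ℂ, ‖ω‖ = 1 → ‖polyEval (fun i => C₀ i + ω • C₁ i) f‖ ≤ c) :
    ‖polyEval (fun i => toeplitz (C₀ i) (C₁ i)) f‖ ≤ c := by
  let t : Fin k → Module.End ℂ (ℕ →₀ E) := fun i =>
    Finsupp.mapRange.linearMap (C₀ i : E →ₗ[ℂ] E) +
      Finsupp.lmapDomain E ℂ Nat.succ ∘ₗ Finsupp.mapRange.linearMap (C₁ i : E →ₗ[ℂ] E)
  have ht : ∀ i n e, t i (Finsupp.single n e) =
      Finsupp.single n (C₀ i e) + Finsupp.single (n + 1) (C₁ i e) := by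
    intro i n e
    simp [t]
  have h1 : ∀ v, ofFinsupp (ordEval t f v) =
      polyEval (fun i => toeplitz (C₀ i) (C₁ i)) f (ofFinsupp v) := by
    intro v
    rw [← ContinuousLinearMap.coe_coe, coe_polyEval]
    refine ordEval_intertwine ofFinsupp (fun i v => ?_) f v
    induction v using Finsupp.induction_linear with
    | zero => simp
    | add v w hv hw => rw [map_add, map_add, map_add, map_add, hv, hw]
    | single n e =>
      rw [ht, map_add, ofFinsupp_single, ofFinsupp_single, ofFinsupp_single,
        ContinuousLinearMap.coe_coe, toeplitz_apply, ampl_single, ampl_single, shift_single]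
  have h2 : ∀ ω v, polyVal ω (ordEval t f v) =
      polyEval (fun i => C₀ i + ω • C₁ i) f (polyVal ω v) := by
    intro ω v
    rw [← ContinuousLinearMap.coe_coe, coe_polyEval]
    refine ordEval_intertwine (polyVal ω) (fun i v => ?_) f v
    induction v using Finsupp.induction_linear with
    | zero => simp
    | add v w hv hw => rw [map_add, map_add, map_add, map_add, hv, hw]
    | single n e =>
      rw [ht, map_add, polyVal_single, polyVal_single, polyVal_single,
        ContinuousLinearMap.coe_coe, map_smul, add_apply, smul_apply, smul_add, smul_smul,
        pow_succ]
  have hfin : ∀ v, ‖polyEval (fun i => toeplitz (C₀ i) (C₁ i)) f (ofFinsupp v)‖ ≤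
      c * ‖ofFinsupp v‖ := by
    intro v
    obtain ⟨N, hN⟩ : ∃ N, v.support ∪ (ordEval t f v).support ⊆ Finset.range N :=
      Finset.exists_nat_subset_range _
    have hN1 : v.support ⊆ Finset.range (N + 1) := fun x hx =>
      Finset.range_mono N.le_succ (hN (Finset.mem_union_left _ hx))
    have hN2 : (ordEval t f v).support ⊆ Finset.range (N + 1) := fun x hx =>
      Finset.range_mono N.le_succ (hN (Finset.mem_union_right _ hx))
    have hζ := Complex.isPrimitiveRoot_exp (N + 1) N.succ_ne_zero
    have e1 := sum_norm_polyVal_sq N.succ_ne_zero hζ hN1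
    have e2 := sum_norm_polyVal_sq N.succ_ne_zero hζ hN2
    rw [← h1, ← sq_le_sq₀ (norm_nonneg _) (by positivity), mul_pow]
    have hpos : (0 : ℝ) < (N + 1 : ℕ) := by positivity
    refine le_of_mul_le_mul_left ?_ hpos
    rw [← e2, mul_left_comm, ← e1, Finset.mul_sum]
    refine Finset.sum_le_sum fun j _ => ?_
    rw [h2, ← mul_pow]
    refine pow_le_pow_left₀ (norm_nonneg _) (ContinuousLinearMap.le_of_opNorm_le _ (h _ ?_) _) 2
    rw [norm_pow, hζ.norm'_eq_one N.succ_ne_zero, one_pow]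
  refine ContinuousLinearMap.opNorm_le_bound _ hc fun x => ?_
  exact denseRange_ofFinsupp.induction_on
    (p := fun x => ‖polyEval (fun i => toeplitz (C₀ i) (C₁ i)) f x‖ ≤ c * ‖x‖) x
    (isClosed_le (by fun_prop) (by fun_prop)) hfin

end SeqSpace

end Hardy

/-! ### The functional model of a pure contraction -/

section Model

open SeqSpace

variable {H E F : Type*}
  [NormedAddCommGroup H] [InnerProductSpace ℂ H] [CompleteSpace H]
  [NormedAddCommGroup E] [InnerProductSpace ℂ E] [CompleteSpace E]
  [NormedAddCommGroup F] [InnerProductSpace ℂ F] [CompleteSpace F]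

namespace IsDefectColligation

variable {P : H →L[ℂ] H} {d : H →L[ℂ] E} {e : H →L[ℂ] F} {p : E →L[ℂ] F}

theorem norm_e_sq (c : IsDefectColligation P d e p) (h : H) :
    ‖e h‖ ^ 2 = ‖h‖ ^ 2 - ‖(P†) h‖ ^ 2 := by
  have h1 : inner ℂ (e h) (e h) = inner ℂ h h - inner ℂ ((P†) h) ((P†) h) := by
    rw [← adjoint_inner_left, c.adj_e_e, inner_sub_left, ← adjoint_inner_right P]
  have h2 := congrArg Complex.re h1
  rw [Complex.sub_re] at h2
  simpa only [← RCLike.re_to_complex, inner_self_eq_norm_sq] using h2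

theorem sum_norm_e_sq (c : IsDefectColligation P d e p) (h : H) (N : ℕ) :
    ∑ n ∈ Finset.range N, ‖e ((P† ^ n) h)‖ ^ 2 = ‖h‖ ^ 2 - ‖(P† ^ N) h‖ ^ 2 := by
  simp only [c.norm_e_sq]
  have := Finset.sum_range_sub' (fun n => ‖(P† ^ n) h‖ ^ 2) N
  simp only [pow_succ' (P†), mul_apply_eq_comp] at this
  exact this

/-- The model map `h ↦ ∑ zⁿ D_{P*} P*ⁿ h` into the Hardy space of `𝒟_{P*}`. -/
noncomputable def modelMap (c : IsDefectColligation P d e p) : H →L[ℂ] SeqSpace F :=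
  opOfCoeff (fun n => ((e ∘L P† ^ n : H →L[ℂ] F) : H →ₗ[ℂ] F)) 1 zero_le_one fun h N => by
    rw [one_mul]
    exact (c.sum_norm_e_sq h N).trans_le (sub_le_self _ (by positivity))

theorem coord_modelMap (c : IsDefectColligation P d e p) (h : H) (n : ℕ) :
    coord n (c.modelMap h) = e ((P† ^ n) h) := rfl

theorem modelMap_adjoint (c : IsDefectColligation P d e p) (h : H) :
    c.modelMap ((P†) h) = (shift†) (c.modelMap h) := by
  ext n
  rw [coord_adjoint_shift, coord_modelMap, coord_modelMap, pow_succ]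
  rfl

theorem modelMap_eq (c : IsDefectColligation P d e p) (h : H) :
    c.modelMap h = const (e h) + shift (c.modelMap ((P†) h)) := by
  rw [c.modelMap_adjoint]
  exact (const_add_shift (c.modelMap h)).symm

theorem adjoint_modelMap_shift (c : IsDefectColligation P d e p) (x : SeqSpace F) :
    (c.modelMap†) (shift x) = P ((c.modelMap†) x) := by
  have key : c.modelMap ∘L P† = shift† ∘L c.modelMap := ContinuousLinearMap.ext c.modelMap_adjoint
  have := congrArg (fun X => (X†) x) key
  simpa [adjoint_comp] using this.symm

theorem adjoint_modelMap_const (c : IsDefectColligation P d e p) (y : F) :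
    (c.modelMap†) (const y) = (e†) y := by
  refine ext_inner_right ℂ fun h => ?_
  rw [adjoint_inner_left, inner_const_left, adjoint_inner_left, coord_modelMap]
  rfl

/-- Purity of `P` makes the model map an isometry. -/
theorem adjoint_modelMap_modelMap (c : IsDefectColligation P d e p)
    (hP : ∀ h, Filter.Tendsto (fun n : ℕ => (P† ^ n) h) Filter.atTop (nhds 0)) (h : H) :
    (c.modelMap†) (c.modelMap h) = h := by
  have hnorm : ∀ h, ‖c.modelMap h‖ = ‖h‖ := by
    intro h
    rw [← sq_eq_sq₀ (norm_nonneg _) (norm_nonneg _)]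
    refine tendsto_nhds_unique (hasSum_norm_sq (c.modelMap h)).tendsto_sum_nat ?_
    simp only [coord_modelMap, c.sum_norm_e_sq]
    have := (hP h).norm.pow 2
    simpa using this.const_sub (‖h‖ ^ 2)
  have h1 : c.modelMap† ∘L c.modelMap = 1 := (norm_map_iff_adjoint_comp_self _).1 hnorm
  exact DFunLike.congr_fun h1 h

/-- The characteristic function as an operator from `𝒟_P` to the Hardy space: `x ↦ Θ_P(·) x`. -/
noncomputable def charSeq (c : IsDefectColligation P d e p) : E →L[ℂ] SeqSpace F :=
  -(const ∘L p) + shift ∘L c.modelMap ∘L d†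

theorem charSeq_apply (c : IsDefectColligation P d e p) (x : E) :
    c.charSeq x = -const (p x) + shift (c.modelMap ((d†) x)) := rfl

theorem evalAt_charSeq (c : IsDefectColligation P d e p) {z : ℂ} (hz : ‖z‖ < 1) {R : H →L[ℂ] H}
    (hR : ∀ h, R h - z • (P†) (R h) = h) (x : E) :
    evalAt z (c.charSeq x) = -p x + z • e (R ((d†) x)) := by
  have h1 : ∀ h, evalAt z (c.modelMap h) = e (R h) := by
    intro h
    have : resolventShift z (c.modelMap h) = c.modelMap (R h) := by
      conv_lhs => rw [← hR h]
      rw [map_sub, map_smul, c.modelMap_adjoint, inverse_one_sub_apply hz]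
    rw [evalAt, this, coord_modelMap]
    rfl
  rw [charSeq_apply, evalAt_add, evalAt_neg, evalAt_const hz, evalAt_shift hz, h1]

theorem adjoint_modelMap_charSeq (c : IsDefectColligation P d e p)
    (hP : ∀ h, Filter.Tendsto (fun n : ℕ => (P† ^ n) h) Filter.atTop (nhds 0)) (x : E) :
    (c.modelMap†) (c.charSeq x) = 0 := by
  rw [charSeq_apply, map_add, map_neg, adjoint_modelMap_const, adjoint_modelMap_shift,
    c.adjoint_modelMap_modelMap hP, c.adj_e_p, neg_add_cancel]

/-- The range of `1 - W W*`, with `W` the model map, lies in the closed shift-invariant subspace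
generated by the characteristic function. -/
theorem comp_modelMap_adjoint (c : IsDefectColligation P d e p)
    (Y : SeqSpace F →L[ℂ] H) (hY : ∀ n x, Y ((shift ^ n) (c.charSeq x)) = 0) (x : SeqSpace F) :
    Y (c.modelMap ((c.modelMap†) x)) = Y x := by
  have key : ∀ (n : ℕ) (Y : SeqSpace F →L[ℂ] H) (_ : ∀ n x, Y ((shift ^ n) (c.charSeq x)) = 0)
      (y : F), Y (c.modelMap ((c.modelMap†) ((shift ^ n) (const y)))) =
        Y ((shift ^ n) (const y)) := by
    intro n
    induction n with
    | zero =>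
      intro Y hY y
      have h0 : c.modelMap ((e†) y) = const y + c.charSeq ((p†) y) := by
        rw [c.modelMap_eq, c.e_adj_e, charSeq_apply, c.adj_d_p, map_sub]
        abel
      rw [pow_zero, one_apply_eq_self, c.adjoint_modelMap_const, h0, map_add]
      simpa using hY 0 ((p†) y)
    | succ n ih =>
      intro Y hY y
      rw [pow_succ', mul_apply_eq_comp, c.adjoint_modelMap_shift]
      have h1 := ih (Y ∘L shift) (fun n x => by
        have := hY (n + 1) x
        rwa [pow_succ', mul_apply_eq_comp] at this) y
      rw [comp_apply, comp_apply] at h1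
      rw [← h1]
      set h := (c.modelMap†) ((shift ^ n) (const y))
      have h2 : shift (c.modelMap h) = c.modelMap (P h) + c.charSeq (d h) := by
        rw [c.modelMap_eq (P h), charSeq_apply, c.p_d, c.adj_d_d, map_sub, map_sub]
        abel
      rw [h2, map_add]
      simpa using hY 0 (d h)
  have : Y ∘L c.modelMap ∘L c.modelMap† = Y := eq_of_shift_pow_const fun n y => key n Y hY y
  exact DFunLike.congr_fun this x

/-- The compression to `H` of the Toeplitz operator with symbol `B* + z B'`. -/
noncomputable def compress (c : IsDefectColligation P d e p) (B B' : F →L[ℂ] F) : H →L[ℂ] H :=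
  c.modelMap† ∘L toeplitz (B†) B' ∘L c.modelMap

section Intertwining

variable {A A' : E →L[ℂ] E} {B B' : F →L[ℂ] F}

/-- The relation `(B* + z B') Θ_P(z) = Θ_P(z) (A + z A'*)` on the level of Taylor coefficients. -/
def CharIntertwine (c : IsDefectColligation P d e p) (A A' : E →L[ℂ] E) (B B' : F →L[ℂ] F) :
    Prop :=
  ∀ x, toeplitz (B†) B' (c.charSeq x) = c.charSeq (A x) + shift (c.charSeq ((A'†) x))

theorem compress_adjoint_modelMap (c : IsDefectColligation P d e p)
    (hP : ∀ h, Filter.Tendsto (fun n : ℕ => (P† ^ n) h) Filter.atTop (nhds 0))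
    (hc : c.CharIntertwine A A' B B') (x : SeqSpace F) :
    (c.modelMap†) (toeplitz (B†) B' x) = c.compress B B' ((c.modelMap†) x) := by
  refine (c.comp_modelMap_adjoint (c.modelMap† ∘L toeplitz (B†) B') (fun n x => ?_) x).symm
  have hT : ∀ y, toeplitz (B†) B' ((shift ^ n) y) = (shift ^ n) (toeplitz (B†) B' y) := by
    induction n with
    | zero => intro y; rfl
    | succ n ih => intro y; rw [pow_succ', mul_apply_eq_comp, mul_apply_eq_comp, toeplitz_shift, ih]
  have hW : ∀ y, (c.modelMap†) ((shift ^ n) y) = (P ^ n) ((c.modelMap†) y) := by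
    clear hT
    induction n with
    | zero => intro y; rfl
    | succ n ih =>
      intro y
      rw [pow_succ', mul_apply_eq_comp, c.adjoint_modelMap_shift, pow_succ', mul_apply_eq_comp, ih]
  rw [comp_apply, hT, hW, hc x, map_add, c.adjoint_modelMap_shift, c.adjoint_modelMap_charSeq hP,
    c.adjoint_modelMap_charSeq hP]
  simp

theorem compress_comm_P (c : IsDefectColligation P d e p)
    (hP : ∀ h, Filter.Tendsto (fun n : ℕ => (P† ^ n) h) Filter.atTop (nhds 0))
    (hc : c.CharIntertwine A A' B B') (h : H) :
    c.compress B B' (P h) = P (c.compress B B' h) := by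
  conv_lhs => rw [← c.adjoint_modelMap_modelMap hP h]
  rw [← c.adjoint_modelMap_shift, ← c.compress_adjoint_modelMap hP hc, toeplitz_shift,
    c.adjoint_modelMap_shift, c.compress_adjoint_modelMap hP hc, c.adjoint_modelMap_modelMap hP]

/-- `(B, B')` solve the fundamental equations of the adjoints of the compressions. -/
theorem fundamental_compress (c : IsDefectColligation P d e p) (h : H) :
    (e†) (B (e h)) = ((c.compress B B')†) h - c.compress B' B ((P†) h) := by
  have h1 : ((c.compress B B')†) h =
      (c.modelMap†) (ampl B (c.modelMap h) + ampl (B'†) ((shift†) (c.modelMap h))) := by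
    simp only [compress, toeplitz, adjoint_comp, map_add, adjoint_adjoint, adjoint_ampl,
      comp_apply, add_apply]
  have h2 : c.compress B' B ((P†) h) =
      (c.modelMap†) (ampl (B'†) ((shift†) (c.modelMap h)) +
        shift (ampl B ((shift†) (c.modelMap h)))) := by
    rw [← c.modelMap_adjoint]
    rfl
  rw [h1, h2, ← map_sub, ← c.adjoint_modelMap_const, ← ampl_const, ← ampl_shift]
  refine congrArg _ ?_
  have h3 := const_add_shift (c.modelMap h)
  rw [coord_modelMap] at h3
  have h4 : const (e h) = c.modelMap h - shift ((shift†) (c.modelMap h)) :=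
    eq_sub_of_add_eq h3
  rw [h4, map_sub]
  abel

theorem CharIntertwine.coeff_zero {c : IsDefectColligation P d e p}
    (hc : c.CharIntertwine A A' B B') (x : E) : p (A x) = (B†) (p x) := by
  have h := congrArg (coord 0) (hc x)
  simp only [toeplitz_apply, charSeq_apply, map_add, map_neg, coord_zero_shift, coord_ampl,
    coord_zero_const, add_zero, map_zero, neg_zero] at h
  exact (neg_injective h).symm

theorem CharIntertwine.coeff_one {c : IsDefectColligation P d e p}
    (hc : c.CharIntertwine A A' B B') (x : E) :
    (B†) (e ((d†) x)) - B' (p x) = e ((d†) (A x)) - p ((A'†) x) := by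
  have h := congrArg (coord (0 + 1)) (hc x)
  simp only [toeplitz_apply, charSeq_apply, map_add, map_neg, coord_succ_shift, coord_ampl,
    coord_zero_const, coord_succ_const, coord_modelMap, coord_zero_shift, pow_zero, neg_zero,
    zero_add, add_zero, one_apply_eq_self, map_zero] at h
  rw [sub_eq_add_neg, sub_eq_add_neg, ← h, add_comm]

theorem CharIntertwine.coeff_succ_succ {c : IsDefectColligation P d e p}
    (hc : c.CharIntertwine A A' B B') (n : ℕ) (x : E) :
    (B†) (e ((P† ^ (n + 1)) ((d†) x))) + B' (e ((P† ^ n) ((d†) x))) =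
      e ((P† ^ (n + 1)) ((d†) (A x))) + e ((P† ^ n) ((d†) ((A'†) x))) := by
  have h := congrArg (coord (n + 1 + 1)) (hc x)
  simpa only [toeplitz_apply, charSeq_apply, map_add, map_neg, coord_succ_shift, coord_ampl,
    coord_succ_const, coord_modelMap, neg_zero, zero_add, map_zero] using h

/-- `D_P S_{n-i} = A_{n-i} D_P + A_i* D_P P`: the higher Taylor coefficients say that the model map
kills the adjoint of the difference. -/
theorem d_compress (c : IsDefectColligation P d e p)
    (hP : ∀ h, Filter.Tendsto (fun n : ℕ => (P† ^ n) h) Filter.atTop (nhds 0))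
    (hc : c.CharIntertwine A A' B B') (hc' : c.CharIntertwine A' A B' B) (h : H) :
    d (c.compress B' B h) = A' (d h) + (A†) (d (P h)) := by
  set T := c.compress B' B with hT
  have hTP := c.compress_comm_P hP hc'
  have hTP' : ∀ n y, (T†) ((P† ^ n) y) = (P† ^ n) ((T†) y) := by
    intro n
    induction n with
    | zero => intro y; rfl
    | succ n ih =>
      intro y
      rw [pow_succ', mul_apply_eq_comp, mul_apply_eq_comp, adjoint_apply_comm hTP, ih]
  have hadj : ∀ x, (T†) ((d†) x) = (P†) ((d†) (A x)) + (d†) ((A'†) x) := by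
    intro x
    have h0 : c.modelMap ((T†) ((d†) x)) =
        c.modelMap ((P†) ((d†) (A x)) + (d†) ((A'†) x)) := by
      ext n
      rw [coord_modelMap, coord_modelMap, ← hTP', map_add, map_add]
      have h1 := c.B_comp_e (S := c.compress B B') (T := T) hTP c.fundamental_compress
        c.fundamental_compress ((P† ^ n) ((d†) x))
      have h2 := hc.coeff_succ_succ n x
      rw [add_comm, pow_succ', mul_apply_eq_comp] at h2
      rw [← h1, h2, ← pow_succ', pow_succ, mul_apply_eq_comp]
    have := congrArg (c.modelMap†) h0
    rwa [c.adjoint_modelMap_modelMap hP, c.adjoint_modelMap_modelMap hP] at this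
  have key : T† ∘L d† = P† ∘L d† ∘L A + d† ∘L A'† := ContinuousLinearMap.ext hadj
  have := congrArg (fun X => (X†) h) key
  simp only [map_add, adjoint_comp, adjoint_adjoint, add_apply, comp_apply] at this
  rw [this, add_comm]

end Intertwining

end IsDefectColligation

end Model

/-! ### The two halves of the theorem -/

section Main

open scoped ComplexConjugate
open SeqSpace

variable {H : Type*} [NormedAddCommGroup H] [InnerProductSpace ℂ H] [CompleteSpace H] {m : ℕ}

omit [CompleteSpace H] in
theorem IsGammaContraction.norm_last_le {S : Fin m → (H →L[ℂ] H)} {P : H →L[ℂ] H}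
    (h : IsGammaContraction (Fin.snoc S P : Fin (m + 1) → (H →L[ℂ] H))) : ‖P‖ ≤ 1 := by
  obtain ⟨Φ, hΦ, hX⟩ := exists_algHom_of_commute h.1
  have h1 := h.2.2 (MvPolynomial.X (Fin.last m))
  rw [hΦ, hX, Fin.snoc_last] at h1
  refine h1.trans (Real.sSup_le ?_ zero_le_one)
  rintro _ ⟨_, hs, rfl⟩
  obtain ⟨z, hz, rfl⟩ := mem_closedSymDisc_iff.1 hs
  -- the last coordinate of a point of `Γ` is the product of the `z j`
  have hcard : Finset.powersetCard (m + 1) (Finset.univ : Finset (Fin (m + 1))) =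
      {Finset.univ} := by
    simpa using Finset.powersetCard_self (Finset.univ : Finset (Fin (m + 1)))
  simp only [MvPolynomial.eval_X, symMap, Fin.val_last, hcard, Finset.sum_singleton, norm_prod]
  exact Finset.prod_le_one (fun _ _ => norm_nonneg _) fun j _ => hz j

theorem weight_ne_zero (i : Fin m) : ((m : ℂ) - (i.val : ℂ)) / ((m : ℂ) + 1) ≠ 0 := by
  refine div_ne_zero (sub_ne_zero.2 ?_) (by exact_mod_cast Nat.succ_ne_zero m)
  exact_mod_cast (ne_of_lt i.2).symm

theorem commute_snoc {R : Type*} [Mul R] {S : Fin m → R} {P : R}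
    (hS : ∀ i j, Commute (S i) (S j)) (hSP : ∀ i, Commute (S i) P) (i j : Fin (m + 1)) :
    Commute ((Fin.snoc S P : Fin (m + 1) → R) i) ((Fin.snoc S P : Fin (m + 1) → R) j) := by
  induction i using Fin.lastCases with
  | last =>
    induction j using Fin.lastCases with
    | last => exact Commute.refl _
    | cast j => rw [Fin.snoc_last, Fin.snoc_castSucc]; exact (hSP j).symm
  | cast i =>
    induction j using Fin.lastCases with
    | last => rw [Fin.snoc_last, Fin.snoc_castSucc]; exact hSP i
    | cast j => rw [Fin.snoc_castSucc, Fin.snoc_castSucc]; exact hS i j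

/-- If the isometry `W` satisfies `W* T_i = T'_i W*`, then polynomials in `T'` are compressions of
polynomials in `T`. -/
theorem norm_polyEval_compress_le {K : Type*} [NormedAddCommGroup K] [InnerProductSpace ℂ K]
    [CompleteSpace K] {k : ℕ} {W : H →L[ℂ] K} (hW : ‖W‖ ≤ 1) (hW' : ∀ h, (W†) (W h) = h)
    {T : Fin k → (K →L[ℂ] K)} {T' : Fin k → (H →L[ℂ] H)}
    (h : ∀ i x, (W†) (T i x) = T' i ((W†) x)) (f : MvPolynomial (Fin k) ℂ) :
    ‖polyEval T' f‖ ≤ ‖polyEval T f‖ := by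
  refine ContinuousLinearMap.opNorm_le_bound _ (norm_nonneg _) fun x => ?_
  have hint := polyEval_intertwine (W†) h f (W x)
  rw [hW'] at hint
  rw [← hint]
  refine (ContinuousLinearMap.le_of_opNorm_le _ ((LinearIsometryEquiv.norm_map _ _).trans_le hW)
    _).trans ?_
  rw [one_mul]
  refine (ContinuousLinearMap.le_opNorm _ _).trans ?_
  exact mul_le_mul_of_nonneg_left ((W.le_of_opNorm_le hW x).trans_eq (one_mul _)) (norm_nonneg _)

section Pencil

variable {F : Type*} [NormedAddCommGroup F] [InnerProductSpace ℂ F] [CompleteSpace F]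
  {B : Fin m → (F →L[ℂ] F)}

theorem commute_pencil (hB : ∀ z : ℂ, ‖z‖ < 1 → IsGammaContraction (weightedPencil B z))
    (i j : Fin m) {z : ℂ} (hz : ‖z‖ < 1) :
    Commute ((B i)† + z • B i.rev) ((B j)† + z • B j.rev) := by
  have h := ((hB z hz).1 i j).smul_left (((m : ℂ) - (i.val : ℂ)) / ((m : ℂ) + 1))⁻¹
    |>.smul_right (((m : ℂ) - (j.val : ℂ)) / ((m : ℂ) + 1))⁻¹
  rw [weightedPencil, weightedPencil, inv_smul_smul₀ (weight_ne_zero i),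
    inv_smul_smul₀ (weight_ne_zero j)] at h
  exact h

theorem mem_of_norm_eq_one {s : Set ℂ} (hs : IsClosed s) (h : ∀ z : ℂ, ‖z‖ < 1 → z ∈ s) {ω : ℂ}
    (hω : ‖ω‖ = 1) : ω ∈ s := by
  have h1 : ω ∈ closure (Metric.ball (0 : ℂ) 1) := by
    rw [closure_ball 0 one_ne_zero]
    simp [hω]
  exact closure_minimal (fun z hz => h z (by simpa using hz)) hs h1

/-- Over a point `ω` of the circle the pencil `B_i* + ω B_{n-i}` is a commuting normal tuple, so
the Toeplitz operators with these symbols, together with the shift, have `Γ_{m+1}` as a spectral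
set. -/
theorem norm_polyEval_toeplitz_snoc_le
    (hB : ∀ z : ℂ, ‖z‖ < 1 → IsGammaContraction (weightedPencil B z))
    (f : MvPolynomial (Fin (m + 1)) ℂ) :
    ‖polyEval (Fin.snoc (fun i => toeplitz ((B i)†) (B i.rev)) shift :
        Fin (m + 1) → (SeqSpace F →L[ℂ] SeqSpace F)) f‖ ≤
      sSup ((fun s => ‖MvPolynomial.eval s f‖) '' closedSymDisc (m + 1)) := by
  have hT : (Fin.snoc (fun i => toeplitz ((B i)†) (B i.rev)) shift :
        Fin (m + 1) → (SeqSpace F →L[ℂ] SeqSpace F)) = fun i => toeplitz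
      ((Fin.snoc (fun i => (B i)†) 0 : Fin (m + 1) → (F →L[ℂ] F)) i)
      ((Fin.snoc (fun i => B i.rev) 1 : Fin (m + 1) → (F →L[ℂ] F)) i) := by
    funext i
    induction i using Fin.lastCases with
    | last =>
      simp only [Fin.snoc_last]
      refine ContinuousLinearMap.ext fun x => ?_
      have h0 : ampl (0 : F →L[ℂ] F) x = 0 := SeqSpace.ext fun n => by rw [coord_ampl]; simp
      have h1 : ampl (1 : F →L[ℂ] F) x = x := SeqSpace.ext fun n => by rw [coord_ampl]; simp
      rw [toeplitz_apply, h0, h1, zero_add]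
    | cast i => simp only [Fin.snoc_castSucc]
  rw [hT]
  refine norm_polyEval_toeplitz_le _ _ f
    (Real.sSup_nonneg (by rintro _ ⟨_, _, rfl⟩; exact norm_nonneg _)) fun ω hω => ?_
  have hN : (fun i => (Fin.snoc (fun i => (B i)†) 0 : Fin (m + 1) → (F →L[ℂ] F)) i +
      ω • (Fin.snoc (fun i => B i.rev) 1 : Fin (m + 1) → (F →L[ℂ] F)) i) =
      (Fin.snoc (fun i => (B i)† + ω • B i.rev) (ω • 1) : Fin (m + 1) → (F →L[ℂ] F)) := by
    funext i
    induction i using Fin.lastCases with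
    | last => simp only [Fin.snoc_last, zero_add]
    | cast i => simp only [Fin.snoc_castSucc]
  rw [hN]
  have hω' : conj ω * ω = 1 := by
    rw [mul_comm, Complex.mul_conj, Complex.normSq_eq_norm_sq, hω]; simp
  have hcont : ∀ i, Continuous fun z : ℂ => (B i)† + z • B i.rev := fun i => by fun_prop
  refine norm_polyEval_snoc_le hω (fun i j => ?_) (fun i => ?_) (fun g => ?_) f
  · exact mem_of_norm_eq_one
      (s := {z : ℂ | ((B i)† + z • B i.rev) * ((B j)† + z • B j.rev) =
        ((B j)† + z • B j.rev) * ((B i)† + z • B i.rev)})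
      (isClosed_eq ((hcont i).mul (hcont j)) ((hcont j).mul (hcont i)))
      (fun z hz => (commute_pencil hB i j hz).eq) hω
  · rw [map_add, map_smulₛₗ, adjoint_adjoint, Fin.rev_rev, smul_add, smul_smul, hω', one_smul,
      add_comm]
  · exact mem_of_norm_eq_one
      (s := {z : ℂ | ‖polyEval (weightedPencil B z) g‖ ≤
        sSup ((fun s => ‖MvPolynomial.eval s g‖) '' closedSymDisc m)})
      (isClosed_le (continuous_polyEval (T := fun z => weightedPencil B z)
        (fun i => (hcont i).fun_const_smul _) g).norm continuous_const)
      (fun z hz => (hB z hz).2.2 g) hω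

end Pencil

section Model

variable {E F : Type*} [NormedAddCommGroup E] [InnerProductSpace ℂ E] [CompleteSpace E]
  [NormedAddCommGroup F] [InnerProductSpace ℂ F] [CompleteSpace F]
  {P : H →L[ℂ] H} {d : H →L[ℂ] E} {e : H →L[ℂ] F} {p : E →L[ℂ] F}

/-- The intertwining relation of the characteristic function, in terms of Taylor coefficients. -/
theorem IsDefectColligation.charIntertwine_of_pencil (c : IsDefectColligation P d e p)
    (hR : ∀ z : ℂ, ‖z‖ < 1 → IsUnit (1 - z • P†)) {Θ : ℂ → E →L[ℂ] F}
    (hΘ : ∀ z x, Θ z x = -p x + z • e (Ring.inverse (1 - z • P†) ((d†) x)))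
    {A A' : E →L[ℂ] E} {B B' : F →L[ℂ] F}
    (h : ∀ z : ℂ, ‖z‖ < 1 → (B† + z • B') ∘L Θ z = Θ z ∘L (A + z • A'†)) :
    c.CharIntertwine A A' B B' := by
  intro x
  refine eq_of_evalAt fun z hz => ?_
  have hval : ∀ y, evalAt z (c.charSeq y) = Θ z y := by
    intro y
    rw [hΘ]
    exact c.evalAt_charSeq hz (fun h => DFunLike.congr_fun
      (Ring.mul_inverse_cancel _ (hR z hz)) h) y
  rw [evalAt_toeplitz hz, evalAt_add, evalAt_shift hz, hval, hval, hval, ← map_smul, ← map_add]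
  exact DFunLike.congr_fun (h z hz) x

/-- The compressions `S_i` of the Toeplitz operators with symbols `B_i* + z B_{n-i}` to the model
space of a pure contraction `P` form, together with `P`, a `Γ_{m+1}`-contraction with the given
fundamental operators. -/
theorem IsDefectColligation.exists_gammaContraction (c : IsDefectColligation P d e p)
    (hP : ∀ h, Filter.Tendsto (fun n : ℕ => (P† ^ n) h) Filter.atTop (nhds 0))
    {A : Fin m → (E →L[ℂ] E)} {B : Fin m → (F →L[ℂ] F)}
    (hB : ∀ z : ℂ, ‖z‖ < 1 → IsGammaContraction (weightedPencil B z))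
    (hc : ∀ i, c.CharIntertwine (A i) (A i.rev) (B i) (B i.rev)) :
    ∃ S : Fin m → (H →L[ℂ] H),
      IsGammaContraction (Fin.snoc S P : Fin (m + 1) → (H →L[ℂ] H)) ∧
      (∀ i h, (d†) (A i (d h)) = S i h - ((S i.rev)†) (P h)) ∧
      ∀ i h, (e†) (B i (e h)) = ((S i)†) h - S i.rev ((P†) h) := by
  have hW := c.adjoint_modelMap_modelMap hP
  have hc' : ∀ i, c.CharIntertwine (A i.rev) (A i) (B i.rev) (B i) := fun i => by
    simpa only [Fin.rev_rev] using hc i.rev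
  let S : Fin m → (H →L[ℂ] H) := fun i => c.compress (B i) (B i.rev)
  have hS : ∀ i x, (c.modelMap†) (toeplitz ((B i)†) (B i.rev) x) = S i ((c.modelMap†) x) :=
    fun i x => c.compress_adjoint_modelMap hP (hc i) x
  have hSP : ∀ i h, S i (P h) = P (S i h) := fun i h => c.compress_comm_P hP (hc i) h
  have hTP : ∀ (i : Fin m) h, S i.rev (P h) = P (S i.rev h) := fun i => hSP i.rev
  have hrev : ∀ i : Fin m, S i.rev = c.compress (B i.rev) (B i) := fun i => by
    simp only [S, Fin.rev_rev]
  have hSS : ∀ i j, Commute (S i) (S j) := by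
    intro i j
    refine ContinuousLinearMap.ext fun h => ?_
    have h1 : ∀ i j, S i (S j h) = (c.modelMap†) (toeplitz ((B i)†) (B i.rev)
        (toeplitz ((B j)†) (B j.rev) (c.modelMap h))) := fun i j => by rw [hS, hS, hW]
    change S i (S j h) = S j (S i h)
    rw [h1, h1, toeplitz_comm fun z hz => commute_pencil hB i j hz]
  have hFB : ∀ i h, (e†) (B i (e h)) =
      ((S i)†) h - S i.rev ((P†) h) := by
    intro i h
    rw [hrev]
    exact c.fundamental_compress h
  have hcomm : ∀ i j, Commute ((Fin.snoc S P : Fin (m + 1) → (H →L[ℂ] H)) i)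
      ((Fin.snoc S P : Fin (m + 1) → (H →L[ℂ] H)) j) :=
    commute_snoc hSS fun i => ContinuousLinearMap.ext (hSP i)
  have hnorm : ∀ f : MvPolynomial (Fin (m + 1)) ℂ,
      ‖polyEval (Fin.snoc S P : Fin (m + 1) → (H →L[ℂ] H)) f‖ ≤
        sSup ((fun s => ‖MvPolynomial.eval s f‖) '' closedSymDisc (m + 1)) := by
    intro f
    refine le_trans ?_ (norm_polyEval_toeplitz_snoc_le hB f)
    refine norm_polyEval_compress_le norm_opOfCoeff_le hW (fun i x => ?_) f
    induction i using Fin.lastCases with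
    | last => rw [Fin.snoc_last, Fin.snoc_last]; exact c.adjoint_modelMap_shift x
    | cast i => rw [Fin.snoc_castSucc, Fin.snoc_castSucc]; exact hS i x
  refine ⟨S, ⟨hcomm, taylorSpectrum_subset hcomm hnorm, hnorm⟩, fun i h => ?_, hFB⟩
  refine c.fundamental_of_coefficients (hSP i) (hTP i) (hFB i)
    (fun h => by simpa using hFB i.rev h) (hc i).coeff_zero (hc' i).coeff_zero (hc i).coeff_one
    (fun h => c.d_compress hP (hc' i) (hc i) h) (fun h => ?_) h
  rw [hrev]
  exact c.d_compress hP (hc i) (hc' i) h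

end Model

end Main

end SymPolydisc

theorem theorem3p10 {H : Type*} [NormedAddCommGroup H] [InnerProductSpace ℂ H] [CompleteSpace H]
    {m : ℕ} (hm : 1 ≤ m) :
    (∀ (S : Fin m → (H →L[ℂ] H)) (P : H →L[ℂ] H)
        (A : Fin m → (defectSpace P →L[ℂ] defectSpace P))
        (B : Fin m → (defectSpace (adjoint P) →L[ℂ] defectSpace (adjoint P))),
      IsGammaContraction (Fin.snoc S P : Fin (m + 1) → (H →L[ℂ] H)) →
      IsFundamentalTuple S P A →
      IsFundamentalTuple (fun i => adjoint (S i)) (adjoint P) B →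
      ∀ (i : Fin m) (z : ℂ), ‖z‖ < 1 →
        (adjoint (B i) + z • B i.rev) ∘L charFun P z =
          charFun P z ∘L (A i + z • adjoint (A i.rev))) ∧
    (∀ (P : H →L[ℂ] H)
        (A : Fin m → (defectSpace P →L[ℂ] defectSpace P))
        (B : Fin m → (defectSpace (adjoint P) →L[ℂ] defectSpace (adjoint P))),
      IsPureContraction P →
      (∀ z : ℂ, ‖z‖ < 1 → IsGammaContraction (weightedPencil A z)) →
      (∀ z : ℂ, ‖z‖ < 1 → IsGammaContraction (weightedPencil B z)) →
      (∀ (i : Fin m) (z : ℂ), ‖z‖ < 1 →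
        (adjoint (B i) + z • B i.rev) ∘L charFun P z =
          charFun P z ∘L (A i + z • adjoint (A i.rev))) →
      ∃ S : Fin m → (H →L[ℂ] H),
        IsGammaContraction (Fin.snoc S P : Fin (m + 1) → (H →L[ℂ] H)) ∧
        IsFundamentalTuple S P A ∧
        IsFundamentalTuple (fun i => adjoint (S i)) (adjoint P) B) := by
  refine ⟨fun S P A B hS hA hB i z hz => ?_, fun P A B hP _ hB hAB => ?_⟩
  · refine pencil_comp_charFun hS.norm_last_le (fun i => ?_) hA hB i hz
    have := hS.1 i.castSucc (Fin.last m)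
    rwa [Fin.snoc_castSucc, Fin.snoc_last] at this
  · have c := isDefectColligation_defect hP.1
    obtain ⟨S, hS, hSA, hSB⟩ := c.exists_gammaContraction hP.2 hB fun i =>
      c.charIntertwine_of_pencil (fun z hz => isUnit_one_sub_smul_adjoint hP.1 hz)
        (charFun_apply P) (hAB i)
    refine ⟨S, hS, isFundamentalTuple_iff.2 hSA, isFundamentalTuple_iff.2 fun i h => ?_⟩
    rw [adjoint_adjoint]
    exact hSB i h
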